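/- Let $G=(V,E)$ be a tree with node weights $w\colon V\to\mathbb R_+$, edge weights $w\colon E\to\mathbb R_+$ and penalties $\pi\colon E\to\mathbb R_+$, where $\mathbb R_+$ is the set of nonnegative reals. For $e\in E$ let $\delta(e)\subseteq E$ be the set of edges sharing an end node with $e$ (including $e$ itself), and for $F\subseteq E$ let $V(F)$ be the set of end nodes of edges in $F$. The prize-collecting edge dominating set (EDS) problem asks for a set $F\subseteq E$ that minimizes $$\sum_{e\in F}w(e)+\sum_{v\in V(F)}w(v)+\sum_{e\in E:\,F\cap\delta(e)=\emptyset}\pi(e).$$ Theorem. The prize-collecting EDS problem on edge- and node-weighted trees admits a polynomial-time exact algorithm. Precisely, there is a single random access machine program, whose operations are addition, subtraction, comparison and (indirectly addressed) reading and writing of natural numbers and of weights, which, given the number of nodes, a list of the edges of a tree (by their end nodes, in any order) and the weights and penalties, always halts with an optimal solution $F$, and such that (i) for arbitrary real weights and penalties the number of elementary operations is at most a polynomial in $|V|$; and (ii) for rational weights and penalties the running time, with every operation charged the bit lengths of the numbers it handles, is at most a polynomial in the bit length of the instance. -/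

import Mathlib

/-! ## The prize-collecting edge dominating set problem -/

/-- A prize-collecting EDS instance on the finite node set `V` with numbers in `K`: a graph with
nonnegative node weights, edge weights and penalties. Only the values of `edgeWeight` and `penalty`
on edges of the graph matter. -/
structure EDSInstance (V K : Type*) [AddCommGroup K] [LinearOrder K] where
  graph : SimpleGraph V
  nodeWeight : V → K
  edgeWeight : Sym2 V → K
  penalty : Sym2 V → K
  nodeWeight_nonneg : ∀ v, 0 ≤ nodeWeight v
  edgeWeight_nonneg : ∀ e ∈ graph.edgeSet, 0 ≤ edgeWeight e
  penalty_nonneg : ∀ e ∈ graph.edgeSet, 0 ≤ penalty e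

namespace EDSInstance

section problem

variable {V K : Type*} [Fintype V] [AddCommGroup K] [LinearOrder K]

open Classical in
/-- The edge set `E`. -/
noncomputable def edges (I : EDSInstance V K) : Finset (Sym2 V) :=
  {e | e ∈ I.graph.edgeSet}

open Classical in
/-- `δ(e)`: the edges that share an end node with `e`, including `e` itself. -/
noncomputable def dominators (I : EDSInstance V K) (e : Sym2 V) : Finset (Sym2 V) :=
  {f ∈ I.edges | ∃ v, v ∈ e ∧ v ∈ f}

open Classical in
/-- `V(F)`: the end nodes of the edges in `F`. -/
noncomputable def endNodes (_I : EDSInstance V K) (F : Finset (Sym2 V)) : Finset V :=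
  {v | ∃ e ∈ F, v ∈ e}

open Classical in
/-- The edges that are not dominated by `F`. -/
noncomputable def undominated (I : EDSInstance V K) (F : Finset (Sym2 V)) : Finset (Sym2 V) :=
  {e ∈ I.edges | Disjoint F (I.dominators e)}

/-- The objective value of `F`: edge weights, node weights of the end nodes (each node counted
once) and penalties of the undominated edges. -/
noncomputable def objective (I : EDSInstance V K) (F : Finset (Sym2 V)) : K :=
  ∑ e ∈ F, I.edgeWeight e + ∑ v ∈ I.endNodes F, I.nodeWeight v
    + ∑ e ∈ I.undominated F, I.penalty e

/-- `F` is an optimal solution: a set of edges of minimum objective value. -/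
def IsOptimal (I : EDSInstance V K) (F : Finset (Sym2 V)) : Prop :=
  F ⊆ I.edges ∧ ∀ F' ⊆ I.edges, I.objective F ≤ I.objective F'

end problem

end EDSInstance

/-! ## A random access machine with a step count

Programs are finite and work on finitely many named arrays. Some arrays hold natural numbers, which
are also used as indices (indirect addressing); the others hold numbers from an ordered additive
group `K`. The only arithmetic operations are addition and subtraction, the only tests are
comparisons, and the only constant of `K` is zero. -/

namespace RAM

/-- Memory contents: `nat a i` and `num a i` are the entries at index `i` of the natural-number
array `a` and of the `K`-valued array `a`. -/
structure State (K : Type*) where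
  nat : ℕ → ℕ → ℕ
  num : ℕ → ℕ → K

/-- Expressions for natural numbers; `get a i` reads entry `i` of array `a`. -/
inductive NatExpr where
  | const (k : ℕ)
  | get (a : ℕ) (i : NatExpr)
  | add (x y : NatExpr)
  | sub (x y : NatExpr)

/-- Expressions for numbers in `K`; `get a i` reads entry `i` of array `a`. -/
inductive NumExpr where
  | zero
  | get (a : ℕ) (i : NatExpr)
  | add (x y : NumExpr)
  | sub (x y : NumExpr)

/-- Tests. -/
inductive Test where
  | natLe (x y : NatExpr)
  | numLe (x y : NumExpr)
  | not (b : Test)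
  | and (b c : Test)

/-- Programs. `setNat a i x` stores `x` at index `i` of the natural-number array `a`. -/
inductive Program where
  | skip
  | setNat (a : ℕ) (i : NatExpr) (x : NatExpr)
  | setNum (a : ℕ) (i : NatExpr) (x : NumExpr)
  | seq (P Q : Program)
  | cond (b : Test) (P Q : Program)
  | loop (b : Test) (P : Program)

/-- A cost model: the price of producing a natural number, or a number in `K`, by one operation. -/
structure CostModel (K : Type*) where
  nat : ℕ → ℕ
  num : K → ℕ

/-- Unit cost: every operation, including one on numbers of `K`, takes one unit of time. -/
def unitCost (K : Type*) : CostModel K where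
  nat _ := 1
  num _ := 1

/-- The number of bits (with a sign bit) of a rational number in lowest terms. -/
def ratBits (x : ℚ) : ℕ := Nat.size x.num.natAbs + Nat.size x.den + 1

/-- Logarithmic cost for rational numbers: every operation is charged the bit length of its
result; the operands are charged when they are themselves produced. -/
def bitCost : CostModel ℚ where
  nat k := Nat.size k + 1
  num := ratBits

section semantics

variable {K : Type*} [AddCommGroup K] [LinearOrder K]

/-- The value of a natural-number expression (subtraction is truncated at zero). -/
def NatExpr.eval (σ : State K) : NatExpr → ℕ
  | .const k => k
  | .get a i => σ.nat a (i.eval σ)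
  | .add x y => x.eval σ + y.eval σ
  | .sub x y => x.eval σ - y.eval σ

/-- The value of a `K`-valued expression. -/
def NumExpr.eval (σ : State K) : NumExpr → K
  | .zero => 0
  | .get a i => σ.num a (i.eval σ)
  | .add x y => x.eval σ + y.eval σ
  | .sub x y => x.eval σ - y.eval σ

/-- The truth value of a test. -/
def Test.Holds (σ : State K) : Test → Prop
  | .natLe x y => x.eval σ ≤ y.eval σ
  | .numLe x y => x.eval σ ≤ y.eval σ
  | .not b => ¬ b.Holds σ
  | .and b c => b.Holds σ ∧ c.Holds σ

/-- The time for evaluating a natural-number expression: every node is charged for its value. -/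
def NatExpr.time (c : CostModel K) (σ : State K) : NatExpr → ℕ
  | .const k => c.nat k
  | .get a i => i.time c σ + c.nat (σ.nat a (i.eval σ))
  | .add x y => x.time c σ + y.time c σ + c.nat (x.eval σ + y.eval σ)
  | .sub x y => x.time c σ + y.time c σ + c.nat (x.eval σ - y.eval σ)

/-- The time for evaluating a `K`-valued expression. -/
def NumExpr.time (c : CostModel K) (σ : State K) : NumExpr → ℕ
  | .zero => c.num 0
  | .get a i => i.time c σ + c.num (σ.num a (i.eval σ))
  | .add x y => x.time c σ + y.time c σ + c.num (x.eval σ + y.eval σ)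
  | .sub x y => x.time c σ + y.time c σ + c.num (x.eval σ - y.eval σ)

/-- The time for evaluating a test. -/
def Test.time (c : CostModel K) (σ : State K) : Test → ℕ
  | .natLe x y => x.time c σ + y.time c σ + 1
  | .numLe x y => x.time c σ + y.time c σ + 1
  | .not b => b.time c σ + 1
  | .and b d => b.time c σ + d.time c σ + 1

/-- Memory after storing `x` at index `i` of the natural-number array `a`. -/
def State.setNat (σ : State K) (a i x : ℕ) : State K where
  nat := Function.update σ.nat a (Function.update (σ.nat a) i x)
  num := σ.num

/-- Memory after storing `x` at index `i` of the `K`-valued array `a`. -/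
def State.setNum (σ : State K) (a i : ℕ) (x : K) : State K where
  nat := σ.nat
  num := Function.update σ.num a (Function.update (σ.num a) i x)

/-- `Exec c P σ t τ`: the program `P`, started with memory `σ`, halts after time exactly `t`
with memory `τ`, where time is measured in the cost model `c`. -/
inductive Exec (c : CostModel K) : Program → State K → ℕ → State K → Prop where
  | skip (σ : State K) : Exec c .skip σ 1 σ
  | setNat (σ : State K) (a : ℕ) (i x : NatExpr) :
      Exec c (.setNat a i x) σ (i.time c σ + x.time c σ + 1) (σ.setNat a (i.eval σ) (x.eval σ))
  | setNum (σ : State K) (a : ℕ) (i : NatExpr) (x : NumExpr) :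
      Exec c (.setNum a i x) σ (i.time c σ + x.time c σ + 1) (σ.setNum a (i.eval σ) (x.eval σ))
  | seq {P Q : Program} {σ τ ρ : State K} {s t : ℕ} :
      Exec c P σ s τ → Exec c Q τ t ρ → Exec c (.seq P Q) σ (s + t) ρ
  | condTrue {b : Test} {P Q : Program} {σ τ : State K} {t : ℕ} :
      b.Holds σ → Exec c P σ t τ → Exec c (.cond b P Q) σ (b.time c σ + 1 + t) τ
  | condFalse {b : Test} {P Q : Program} {σ τ : State K} {t : ℕ} :
      ¬ b.Holds σ → Exec c Q σ t τ → Exec c (.cond b P Q) σ (b.time c σ + 1 + t) τ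
  | loopDone {b : Test} {P : Program} {σ : State K} :
      ¬ b.Holds σ → Exec c (.loop b P) σ (b.time c σ + 1) σ
  | loopStep {b : Test} {P : Program} {σ τ ρ : State K} {s t : ℕ} :
      b.Holds σ → Exec c P σ s τ → Exec c (.loop b P) τ t ρ →
      Exec c (.loop b P) σ (b.time c σ + 1 + s + t) ρ

end semantics

end RAM

/-! ## Input and output -/

namespace EDSInstance

section encoding

variable {n m : ℕ} {K : Type*} [AddCommGroup K] [LinearOrder K]

/-- `ends` lists every edge of the graph exactly once, in any order, each edge being given by its
two end nodes in any order. -/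
def IsEdgeList (I : EDSInstance (Fin n) K) (ends : Fin m → Fin n × Fin n) : Prop :=
  Set.BijOn (fun j => s((ends j).1, (ends j).2)) Set.univ I.graph.edgeSet

/-- The initial memory. Natural-number array `0` holds the numbers of nodes and of edges, and arrays
`1` and `2` hold the end nodes of the listed edges. Numerical array `0` holds the node weights,
arrays `1` and `2` hold the weights and the penalties of the listed edges. All else is zero. -/
def input (I : EDSInstance (Fin n) K) (ends : Fin m → Fin n × Fin n) : RAM.State K where
  nat a i :=
    match a with
    | 0 => if i = 0 then n else if i = 1 then m else 0
    | 1 => if h : i < m then ((ends ⟨i, h⟩).1 : ℕ) else 0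
    | 2 => if h : i < m then ((ends ⟨i, h⟩).2 : ℕ) else 0
    | _ => 0
  num a i :=
    match a with
    | 0 => if h : i < n then I.nodeWeight ⟨i, h⟩ else 0
    | 1 => if h : i < m then I.edgeWeight s((ends ⟨i, h⟩).1, (ends ⟨i, h⟩).2) else 0
    | 2 => if h : i < m then I.penalty s((ends ⟨i, h⟩).1, (ends ⟨i, h⟩).2) else 0
    | _ => 0

/-- The edge set read off from the final memory: the `j`-th listed edge is chosen if entry `j` of
the natural-number array `3` is `1`. -/
def output (ends : Fin m → Fin n × Fin n) (τ : RAM.State K) : Finset (Sym2 (Fin n)) :=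
  (Finset.univ.filter fun j : Fin m => τ.nat 3 j = 1).image
    fun j => s((ends j).1, (ends j).2)

/-- The number of bits needed to write down an instance with rational numbers. -/
def bitSize (I : EDSInstance (Fin n) ℚ) (ends : Fin m → Fin n × Fin n) : ℕ :=
  ∑ v, RAM.ratBits (I.nodeWeight v) +
    ∑ j, (Nat.size (ends j).1 + Nat.size (ends j).2 +
      RAM.ratBits (I.edgeWeight s((ends j).1, (ends j).2)) +
      RAM.ratBits (I.penalty s((ends j).1, (ends j).2)))

end encoding

end EDSInstance

/-! The proof is a dynamic program that strips leaves off the tree. An edge is dominated exactly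
when one of its ends lies in $V(F)$, so the objective depends on the chosen edges and on which nodes
they cover. Let the tree grow from node `0`, one edge at a time. Relative to the first `k` edges a
node is in state `2` (covered by them), `1` (promised to be covered by a later edge) or `0` (never
covered). Later steps may turn `1` into `2`, but being `0` is final, so the penalty of an edge is
settled once both its ends have states. Removing the last leaf replaces the three costs of its
parent by minima over the state of the leaf; the minimisers are recorded and later read back from
the root outwards. The exchange identity behind both directions is `partialCost_succ`.

A broken promise ought to cost infinity, which `K` does not contain. State `1` is instead priced at
the sum of all penalties: a solution with a broken promise has then paid at least its true
penalties. Hence `IsPartialSolution.coverCost_le` bounds the true cost of the solution read off by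
the root entry, and `min_le_coverCost` bounds the root entry by the cost of every edge choice.

Since the edges come in arbitrary order, each growing round scans the list for an edge with exactly
one marked end. Connectivity provides one (`exists_crossing_edge`), and quadratically many
operations suffice.

For the bit bound, write all inputs over one common denominator `D`. Additions and subtractions keep
`D` and lengthen a numerator by at most one bit, so `t` operations on `b`-bit data never leave `b +
t` bits, and a polynomial operation count becomes a polynomial bit count (`Exec.bit_of_unit`).

Memory layout: numerical arrays `4`, `3`, `0` hold the costs of states `0`, `1`, `2`, and `5` is
scratch. Natural arrays `8`, `9`, `10` hold child, parent and list position of each attached edge,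
`7` the marks, `11`, `12`, `13` the decisions for parent states `0`, `1`, `2`, and `14` the final
states; `4`, `5`, `6` are counters and the edge found. -/

namespace RAM

/-! ### From operation counts to bit complexity -/

/-- The largest constant in a natural-number expression. -/
def NatExpr.maxConst : NatExpr → ℕ
  | .const k => k
  | .get _ i => i.maxConst
  | .add x y => max x.maxConst y.maxConst
  | .sub x y => max x.maxConst y.maxConst

/-- The largest natural-number constant in a `K`-valued expression. -/
def NumExpr.maxConst : NumExpr → ℕ
  | .zero => 0
  | .get _ i => i.maxConst
  | .add x y => max x.maxConst y.maxConst
  | .sub x y => max x.maxConst y.maxConst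

/-- The largest natural-number constant in a test. -/
def Test.maxConst : Test → ℕ
  | .natLe x y => max x.maxConst y.maxConst
  | .numLe x y => max x.maxConst y.maxConst
  | .not b => b.maxConst
  | .and b d => max b.maxConst d.maxConst

/-- The largest natural-number constant in a program. -/
def Program.maxConst : Program → ℕ
  | .skip => 0
  | .setNat _ i x => max i.maxConst x.maxConst
  | .setNum _ i x => max i.maxConst x.maxConst
  | .seq P Q => max P.maxConst Q.maxConst
  | .cond b P Q => max b.maxConst (max P.maxConst Q.maxConst)
  | .loop b P => max b.maxConst P.maxConst

/-- `x` is an integer of absolute value at most `2 ^ b`, divided by `D`. -/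
def IsShortFraction (D b : ℕ) (x : ℚ) : Prop :=
  ∃ z : ℤ, x = z / D ∧ z.natAbs ≤ 2 ^ b

/-- All memory contents are natural numbers up to `2 ^ b` and short fractions. -/
structure State.IsShort (D b : ℕ) (σ : State ℚ) : Prop where
  nat_le : ∀ a i, σ.nat a i ≤ 2 ^ b
  num_short : ∀ a i, IsShortFraction D b (σ.num a i)

theorem two_pow_add_le {a b c : ℕ} (ha : a < c) (hb : b < c) : 2 ^ a + 2 ^ b ≤ 2 ^ c := by
  obtain ⟨c, rfl⟩ : ∃ c', c = c' + 1 := ⟨c - 1, by omega⟩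
  have h1 : 2 ^ a ≤ 2 ^ c := Nat.pow_le_pow_right (by norm_num) (by omega)
  have h2 : 2 ^ b ≤ 2 ^ c := Nat.pow_le_pow_right (by norm_num) (by omega)
  rw [pow_succ]
  omega

theorem size_le_succ {k b : ℕ} (h : k ≤ 2 ^ b) : Nat.size k ≤ b + 1 :=
  Nat.size_le.2 (h.trans_lt (Nat.pow_lt_pow_right (by norm_num) (by omega)))

theorem IsShortFraction.mono {D a b : ℕ} {x : ℚ} (h : IsShortFraction D a x) (hab : a ≤ b) :
    IsShortFraction D b x := by
  obtain ⟨z, hz, hb⟩ := h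
  exact ⟨z, hz, hb.trans (Nat.pow_le_pow_right (by norm_num) hab)⟩

theorem IsShortFraction.zero (D b : ℕ) : IsShortFraction D b 0 :=
  ⟨0, by simp, by simp⟩

theorem IsShortFraction.add {D a b c : ℕ} {x y : ℚ} (hx : IsShortFraction D a x)
    (hy : IsShortFraction D b y) (ha : a < c) (hb : b < c) : IsShortFraction D c (x + y) := by
  obtain ⟨z, rfl, hz⟩ := hx
  obtain ⟨z', rfl, hz'⟩ := hy
  refine ⟨z + z', by push_cast; ring, ?_⟩
  have := two_pow_add_le ha hb
  have := Int.natAbs_add_le z z'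
  omega

theorem IsShortFraction.sub {D a b c : ℕ} {x y : ℚ} (hx : IsShortFraction D a x)
    (hy : IsShortFraction D b y) (ha : a < c) (hb : b < c) : IsShortFraction D c (x - y) := by
  obtain ⟨z, rfl, hz⟩ := hx
  obtain ⟨z', rfl, hz'⟩ := hy
  refine ⟨z - z', by push_cast; ring, ?_⟩
  have := two_pow_add_le ha hb
  have := Int.natAbs_sub_le z z'
  omega

/-- Reduction to lowest terms only shortens: the reduced denominator divides `D` and the reduced
numerator divides `z`. The `3` is one extra bit for each of the two lengths and the sign bit. -/
theorem IsShortFraction.ratBits_le {D b d : ℕ} {x : ℚ} (hx : IsShortFraction D b x) (hD : D ≠ 0)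
    (hd : D ≤ 2 ^ d) : ratBits x ≤ b + d + 3 := by
  obtain ⟨z, rfl, hz⟩ := hx
  have hD' : (D : ℤ) ≠ 0 := by exact_mod_cast hD
  have hden : ((z : ℚ) / D).den ≤ D := by
    have h : ((((z : ℚ) / ((D : ℤ) : ℚ)).den : ℤ)) ∣ (D : ℤ) := by
      rw [← Rat.divInt_eq_div]; exact Rat.den_dvd z D
    exact Nat.le_of_dvd (Nat.pos_of_ne_zero hD) (by exact_mod_cast h)
  have hnum : ((z : ℚ) / D).num.natAbs ≤ 2 ^ b := by
    rcases eq_or_ne z 0 with rfl | h0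
    · simp
    · have h : ((z : ℚ) / ((D : ℤ) : ℚ)).num ∣ z := by
        rw [← Rat.divInt_eq_div]; exact Rat.num_dvd z hD'
      exact (Nat.le_of_dvd (Int.natAbs_pos.2 h0) (Int.natAbs_dvd_natAbs.2 h)).trans hz
  have h1 := size_le_succ hnum
  have h2 := size_le_succ (hden.trans hd)
  unfold ratBits
  omega

theorem State.IsShort.mono {D a b : ℕ} {σ : State ℚ} (h : σ.IsShort D a) (hab : a ≤ b) :
    σ.IsShort D b :=
  ⟨fun x i => (h.nat_le x i).trans (Nat.pow_le_pow_right (by norm_num) hab),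
    fun x i => (h.num_short x i).mono hab⟩

theorem NatExpr.unit_pos {K : Type*} [AddCommGroup K] (σ : State K) (e : NatExpr) :
    0 < e.time (unitCost K) σ := by
  cases e <;> simp [NatExpr.time, unitCost]

theorem NumExpr.unit_pos {K : Type*} [AddCommGroup K] (σ : State K) (e : NumExpr) :
    0 < e.time (unitCost K) σ := by
  cases e <;> simp [NumExpr.time, unitCost]

section transfer

variable {D d C b : ℕ} {σ : State ℚ}

/-- A leaf costs one unit and adds no bit, hence the `- 1`. A sum costs at least one unit more than
either summand, which pays for the carry bit. -/
theorem NatExpr.eval_le (hσ : σ.IsShort D b) : ∀ e : NatExpr, e.maxConst ≤ 2 ^ b →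
    e.eval σ ≤ 2 ^ (b + e.time (unitCost ℚ) σ - 1)
  | .const k, h => by simpa [NatExpr.eval, NatExpr.time, unitCost, NatExpr.maxConst] using h
  | .get a i, _ => (hσ.nat_le a _).trans
      (Nat.pow_le_pow_right (by norm_num) (by simp [NatExpr.time, unitCost]))
  | .add x y, h => by
    have hx := eval_le hσ x (le_trans (le_max_left _ _) h)
    have hy := eval_le hσ y (le_trans (le_max_right _ _) h)
    have hx' := x.unit_pos σ
    have hy' := y.unit_pos σ
    refine (Nat.add_le_add hx hy).trans (two_pow_add_le ?_ ?_) <;>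
      simp only [NatExpr.time, unitCost] at hx' hy' ⊢ <;> omega
  | .sub x y, h => by
    have hx := eval_le hσ x (le_trans (le_max_left _ _) h)
    refine (Nat.sub_le _ _).trans (hx.trans (Nat.pow_le_pow_right (by norm_num) ?_))
    simp only [NatExpr.time, unitCost]
    omega

/-- `C` dominates the price of every single operation, because all intermediate values obey
`NatExpr.eval_le`. The versions for `K`-valued expressions and tests below follow the same count,
with `d` more bits for the denominator. -/
theorem NatExpr.bit_time_le (hσ : σ.IsShort D b) : ∀ e : NatExpr, e.maxConst ≤ 2 ^ b →
    b + e.time (unitCost ℚ) σ + 1 ≤ C →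
    e.time bitCost σ ≤ e.time (unitCost ℚ) σ * C
  | .const k, h, hC => by
    have := size_le_succ (k := k) h
    simp only [NatExpr.time, unitCost, bitCost] at hC ⊢
    omega
  | .get a i, h, hC => by
    have hp := i.unit_pos σ
    simp only [NatExpr.time, unitCost, bitCost] at hC hp ⊢
    have hi := bit_time_le hσ i h (by simp only [unitCost]; omega)
    have := size_le_succ (hσ.nat_le a (i.eval σ))
    simp only [unitCost, bitCost] at hi
    rw [add_mul, one_mul]
    omega
  | .add x y, h, hC => by
    have hx' := x.unit_pos σ
    have hy' := y.unit_pos σ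
    have hs := size_le_succ (eval_le hσ (.add x y) h)
    simp only [NatExpr.time, NatExpr.eval, unitCost, bitCost] at hC hs hx' hy' ⊢
    have hx := bit_time_le hσ x (le_trans (le_max_left _ _) h) (by simp only [unitCost]; omega)
    have hy := bit_time_le hσ y (le_trans (le_max_right _ _) h) (by simp only [unitCost]; omega)
    simp only [unitCost, bitCost] at hx hy
    rw [add_mul, add_mul, one_mul]
    omega
  | .sub x y, h, hC => by
    have hx' := x.unit_pos σ
    have hy' := y.unit_pos σ
    have hs := size_le_succ (eval_le hσ (.sub x y) h)
    simp only [NatExpr.time, NatExpr.eval, unitCost, bitCost] at hC hs hx' hy' ⊢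
    have hx := bit_time_le hσ x (le_trans (le_max_left _ _) h) (by simp only [unitCost]; omega)
    have hy := bit_time_le hσ y (le_trans (le_max_right _ _) h) (by simp only [unitCost]; omega)
    simp only [unitCost, bitCost] at hx hy
    rw [add_mul, add_mul, one_mul]
    omega

theorem NumExpr.eval_short (hσ : σ.IsShort D b) : ∀ e : NumExpr,
    IsShortFraction D (b + e.time (unitCost ℚ) σ - 1) (e.eval σ)
  | .zero => .zero _ _
  | .get a i => (hσ.num_short a _).mono (by simp [NumExpr.time, unitCost])
  | .add x y => by
    have hx' := x.unit_pos σ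
    have hy' := y.unit_pos σ
    refine (eval_short hσ x).add (eval_short hσ y) ?_ ?_ <;>
      simp only [NumExpr.time, unitCost] at hx' hy' ⊢ <;> omega
  | .sub x y => by
    have hx' := x.unit_pos σ
    have hy' := y.unit_pos σ
    refine (eval_short hσ x).sub (eval_short hσ y) ?_ ?_ <;>
      simp only [NumExpr.time, unitCost] at hx' hy' ⊢ <;> omega

theorem NumExpr.bit_time_le (hσ : σ.IsShort D b) (hD : D ≠ 0) (hd : D ≤ 2 ^ d) :
    ∀ e : NumExpr, e.maxConst ≤ 2 ^ b → b + e.time (unitCost ℚ) σ + d + 3 ≤ C →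
    e.time bitCost σ ≤ e.time (unitCost ℚ) σ * C
  | .zero, _, hC => by
    have := (IsShortFraction.zero D b).ratBits_le hD hd
    simp only [NumExpr.time, unitCost, bitCost] at hC ⊢
    omega
  | .get a i, h, hC => by
    simp only [NumExpr.time, unitCost, bitCost] at hC ⊢
    have hi := NatExpr.bit_time_le (C := C) hσ i h (by simp only [unitCost]; omega)
    have := (hσ.num_short a (i.eval σ)).ratBits_le hD hd
    simp only [unitCost, bitCost] at hi
    rw [add_mul, one_mul]
    omega
  | .add x y, h, hC => by
    have hx' := x.unit_pos σ
    have hy' := y.unit_pos σ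
    have hs := (eval_short hσ (.add x y)).ratBits_le hD hd
    simp only [NumExpr.time, NumExpr.eval, unitCost, bitCost] at hC hs hx' hy' ⊢
    have hx := bit_time_le hσ hD hd x (le_trans (le_max_left _ _) h) (by simp only [unitCost]; omega)
    have hy := bit_time_le hσ hD hd y (le_trans (le_max_right _ _) h) (by simp only [unitCost]; omega)
    simp only [unitCost, bitCost] at hx hy
    rw [add_mul, add_mul, one_mul]
    omega
  | .sub x y, h, hC => by
    have hx' := x.unit_pos σ
    have hy' := y.unit_pos σ
    have hs := (eval_short hσ (.sub x y)).ratBits_le hD hd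
    simp only [NumExpr.time, NumExpr.eval, unitCost, bitCost] at hC hs hx' hy' ⊢
    have hx := bit_time_le hσ hD hd x (le_trans (le_max_left _ _) h) (by simp only [unitCost]; omega)
    have hy := bit_time_le hσ hD hd y (le_trans (le_max_right _ _) h) (by simp only [unitCost]; omega)
    simp only [unitCost, bitCost] at hx hy
    rw [add_mul, add_mul, one_mul]
    omega

theorem Test.bit_time_le (hσ : σ.IsShort D b) (hD : D ≠ 0) (hd : D ≤ 2 ^ d) :
    ∀ e : Test, e.maxConst ≤ 2 ^ b → b + e.time (unitCost ℚ) σ + d + 3 ≤ C →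
    e.time bitCost σ ≤ e.time (unitCost ℚ) σ * C
  | .natLe x y, h, hC => by
    simp only [Test.time] at hC ⊢
    have hx := NatExpr.bit_time_le (C := C) hσ x (le_trans (le_max_left _ _) h) (by omega)
    have hy := NatExpr.bit_time_le (C := C) hσ y (le_trans (le_max_right _ _) h) (by omega)
    rw [add_mul, add_mul, one_mul]
    omega
  | .numLe x y, h, hC => by
    simp only [Test.time] at hC ⊢
    have hx := NumExpr.bit_time_le (C := C) hσ hD hd x (le_trans (le_max_left _ _) h) (by omega)
    have hy := NumExpr.bit_time_le (C := C) hσ hD hd y (le_trans (le_max_right _ _) h) (by omega)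
    rw [add_mul, add_mul, one_mul]
    omega
  | .not e, h, hC => by
    simp only [Test.time] at hC ⊢
    have hx := bit_time_le hσ hD hd e h (by omega)
    rw [add_mul, one_mul]
    omega
  | .and x y, h, hC => by
    simp only [Test.time] at hC ⊢
    have hx := bit_time_le hσ hD hd x (le_trans (le_max_left _ _) h) (by omega)
    have hy := bit_time_le hσ hD hd y (le_trans (le_max_right _ _) h) (by omega)
    rw [add_mul, add_mul, one_mul]
    omega

theorem State.IsShort.setNat (hσ : σ.IsShort D b) (a i : ℕ) {x : ℕ} (hx : x ≤ 2 ^ b) :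
    (σ.setNat a i x).IsShort D b := by
  refine ⟨fun a' i' => ?_, hσ.num_short⟩
  simp only [State.setNat, Function.update_apply]
  split_ifs
  · simp only [Function.update_apply]
    split_ifs
    · exact hx
    · exact hσ.nat_le _ _
  · exact hσ.nat_le _ _

theorem State.IsShort.setNum (hσ : σ.IsShort D b) (a i : ℕ) {x : ℚ}
    (hx : IsShortFraction D b x) : (σ.setNum a i x).IsShort D b := by
  refine ⟨hσ.nat_le, fun a' i' => ?_⟩
  simp only [State.setNum, Function.update_apply]
  split_ifs
  · simp only [Function.update_apply]
    split_ifs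
    · exact hx
    · exact hσ.num_short _ _
  · exact hσ.num_short _ _

/-- A computation on short numbers with `t` elementary operations has bit complexity at most
quadratic in `t` and the length of the numbers: every operation lengthens them by at most a bit. -/
theorem Exec.bit_of_unit (hD : D ≠ 0) (hd : D ≤ 2 ^ d) {P : Program} {τ : State ℚ} {t : ℕ}
    (h : Exec (unitCost ℚ) P σ t τ) (hσ : σ.IsShort D b) (hP : P.maxConst ≤ 2 ^ b)
    (hC : b + t + d + 3 ≤ C) :
    τ.IsShort D (b + t) ∧ ∃ t' ≤ t * C, Exec bitCost P σ t' τ := by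
  -- The length `b` has to vary: the second part of a sequence or loop starts on numbers already
  -- lengthened by the first part. As the hypothesis on `C` involves only `b` plus the remaining
  -- time, one `C` serves the whole run.
  induction h generalizing b with
  | skip σ => exact ⟨hσ.mono (by omega), 1, by omega, .skip σ⟩
  | setNat σ a i x =>
    have hi := NatExpr.bit_time_le (C := C) hσ i (le_trans (le_max_left _ _) hP) (by omega)
    have hx := NatExpr.bit_time_le (C := C) hσ x (le_trans (le_max_right _ _) hP) (by omega)
    refine ⟨(hσ.mono (by omega)).setNat _ _ ((NatExpr.eval_le hσ x
      (le_trans (le_max_right _ _) hP)).trans (Nat.pow_le_pow_right (by norm_num) (by omega))),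
      _, ?_, .setNat σ a i x⟩
    rw [add_mul, add_mul, one_mul]
    omega
  | setNum σ a i x =>
    have hi := NatExpr.bit_time_le (C := C) hσ i (le_trans (le_max_left _ _) hP) (by omega)
    have hx := NumExpr.bit_time_le (C := C) hσ hD hd x (le_trans (le_max_right _ _) hP) (by omega)
    refine ⟨(hσ.mono (by omega)).setNum _ _ ((NumExpr.eval_short hσ x).mono (by omega)),
      _, ?_, .setNum σ a i x⟩
    rw [add_mul, add_mul, one_mul]
    omega
  | seq h₁ h₂ ih₁ ih₂ =>
    obtain ⟨hτ, t₁, ht₁, e₁⟩ := ih₁ hσ (le_trans (le_max_left _ _) hP) (by omega)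
    obtain ⟨hρ, t₂, ht₂, e₂⟩ := ih₂ hτ ((le_trans (le_max_right _ _) hP).trans
      (Nat.pow_le_pow_right (by norm_num) (by omega))) (by omega)
    exact ⟨hρ.mono (by omega), _, by rw [add_mul]; omega, .seq e₁ e₂⟩
  | condTrue hb h ih =>
    have hx := Test.bit_time_le (C := C) hσ hD hd _ (le_trans (le_max_left _ _) hP) (by omega)
    obtain ⟨hτ, t₁, ht₁, e₁⟩ := ih hσ
      (le_trans (le_max_left _ _) (le_trans (le_max_right _ _) hP)) (by omega)
    exact ⟨hτ.mono (by omega), _, by rw [add_mul, add_mul, one_mul]; omega, .condTrue hb e₁⟩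
  | condFalse hb h ih =>
    have hx := Test.bit_time_le (C := C) hσ hD hd _ (le_trans (le_max_left _ _) hP) (by omega)
    obtain ⟨hτ, t₁, ht₁, e₁⟩ := ih hσ
      (le_trans (le_max_right _ _) (le_trans (le_max_right _ _) hP)) (by omega)
    exact ⟨hτ.mono (by omega), _, by rw [add_mul, add_mul, one_mul]; omega, .condFalse hb e₁⟩
  | loopDone hb =>
    have hx := Test.bit_time_le (C := C) hσ hD hd _ (le_trans (le_max_left _ _) hP) (by omega)
    exact ⟨hσ.mono (by omega), _, by rw [add_mul, one_mul]; omega, .loopDone hb⟩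
  | loopStep hb h₁ h₂ ih₁ ih₂ =>
    have hx := Test.bit_time_le (C := C) hσ hD hd _ (le_trans (le_max_left _ _) hP) (by omega)
    obtain ⟨hτ, t₁, ht₁, e₁⟩ := ih₁ hσ (le_trans (le_max_right _ _) hP) (by omega)
    obtain ⟨hρ, t₂, ht₂, e₂⟩ := ih₂ hτ (hP.trans
      (Nat.pow_le_pow_right (by norm_num) (by omega))) (by omega)
    exact ⟨hρ.mono (by omega), _, by rw [add_mul, add_mul, add_mul, one_mul]; omega,
      .loopStep hb e₁ e₂⟩

end transfer

end RAM

namespace TreeDP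

open Finset

/-! ### Growing a tree from the root -/

section growth

/-- The root `0` and the first `k` attached nodes. -/
def prefixNodes (c : ℕ → ℕ) (k : ℕ) : Finset ℕ := insert 0 ((range k).image c)

theorem mem_prefixNodes {c : ℕ → ℕ} {k v : ℕ} :
    v ∈ prefixNodes c k ↔ v = 0 ∨ ∃ i < k, v = c i := by
  simp [prefixNodes, eq_comm]

theorem prefixNodes_zero (c : ℕ → ℕ) : prefixNodes c 0 = {0} := by simp [prefixNodes]

theorem prefixNodes_succ (c : ℕ → ℕ) (k : ℕ) :
    prefixNodes c (k + 1) = insert (c k) (prefixNodes c k) := by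
  ext v
  simp only [mem_prefixNodes, mem_insert, Nat.lt_succ_iff_lt_or_eq]
  grind

theorem prefixNodes_mono (c : ℕ → ℕ) {k l : ℕ} (h : k ≤ l) : prefixNodes c k ⊆ prefixNodes c l := by
  intro v
  simp only [mem_prefixNodes]
  grind

theorem child_mem (c : ℕ → ℕ) {i k : ℕ} (h : i < k) : c i ∈ prefixNodes c k :=
  mem_prefixNodes.2 (Or.inr ⟨i, h, rfl⟩)

/-- The nodes `c 0, c 1, …` are attached one after the other to the root `0`, each to an earlier
node `p i`. -/
structure IsGrowth (m : ℕ) (c p : ℕ → ℕ) : Prop where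
  parent_mem : ∀ i < m, p i ∈ prefixNodes c i
  child_notMem : ∀ i < m, c i ∉ prefixNodes c i

variable {m : ℕ} {c p : ℕ → ℕ}

theorem IsGrowth.parent_mem_of_lt (hg : IsGrowth m c p) {i k : ℕ} (hi : i < k) (hk : k ≤ m) :
    p i ∈ prefixNodes c k :=
  prefixNodes_mono c hi.le (hg.parent_mem i (hi.trans_le hk))

/-- For `k = m` and `m + 1` nodes this count shows that the growth reaches every node. -/
theorem IsGrowth.card_prefixNodes (hg : IsGrowth m c p) {k : ℕ} (hk : k ≤ m) :
    #(prefixNodes c k) = k + 1 := by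
  induction k with
  | zero => simp [prefixNodes_zero]
  | succ k ih =>
    rw [prefixNodes_succ, card_insert_of_notMem (hg.child_notMem k hk), ih (by omega)]

end growth

/-! ### Node states and the exchange identity -/

section cost

variable {K : Type*} [AddCommGroup K]

/-- The cost of attaching a child in state `r` to a parent in state `s` (before the attachment),
where `tp` and `tc` are the costs of the states of the parent and of the child. State `0` means not
an end node of a chosen edge, state `1` means not yet an end node of a chosen edge but treated as
one, and state `2` means an end node of a chosen edge. The connecting edge, of weight `w` and
penalty `π`, is chosen if and only if `r = 2`. -/
def attachCost (tp tc : ℕ → K) (w π : K) (s r : ℕ) : K :=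
  if r = 2 then w + tc 2 + tp 2
  else if r = 1 then tc 1 + tp s
  else tc 0 + tp s + if s = 0 then π else 0

open Classical in
/-- The cost of the node states `x` and the edge choice `F` on the first `k` attached nodes. -/
noncomputable def partialCost (c p : ℕ → ℕ) (w π : ℕ → K) (T : ℕ → ℕ → K) (F : ℕ → Prop)
    (x : ℕ → ℕ) (k : ℕ) : K :=
  ∑ v ∈ prefixNodes c k, T v (x v) + ∑ i ∈ range k,
    ((if F i then w i else 0) + if x (c i) = 0 ∧ x (p i) = 0 then π i else 0)

/-- `v` is an end node of one of the first `k` edges that is chosen by `F`. -/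
def Covered (c p : ℕ → ℕ) (F : ℕ → Prop) (k v : ℕ) : Prop :=
  ∃ i < k, F i ∧ (v = c i ∨ v = p i)

open Classical in
/-- The objective value of the edge choice `F`. -/
noncomputable def coverCost (m : ℕ) (c p : ℕ → ℕ) (w π nw : ℕ → K) (F : ℕ → Prop) : K :=
  ∑ v ∈ prefixNodes c m, (if Covered c p F m v then nw v else 0) + ∑ i ∈ range m,
    ((if F i then w i else 0) +
      if ¬ Covered c p F m (c i) ∧ ¬ Covered c p F m (p i) then π i else 0)

variable {m : ℕ} {c p : ℕ → ℕ} {w π : ℕ → K}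

/-- Two edge choices appear because the solution is read off gradually: `F` is the choice before and
`F'` the choice after edge `k` has been decided. -/
theorem covered_succ {k : ℕ} {F F' : ℕ → Prop} (hF : ∀ i < k, F' i ↔ F i) (v : ℕ) :
    Covered c p F' (k + 1) v ↔ Covered c p F k v ∨ F' k ∧ (v = c k ∨ v = p k) := by
  unfold Covered
  constructor
  · rintro ⟨i, hi, hFi, hv⟩
    rcases Nat.lt_succ_iff_lt_or_eq.1 hi with hi | rfl
    · exact Or.inl ⟨i, hi, (hF i hi).1 hFi, hv⟩
    · exact Or.inr ⟨hFi, hv⟩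
  · rintro (⟨i, hi, hFi, hv⟩ | ⟨hFi, hv⟩)
    · exact ⟨i, by omega, (hF i hi).2 hFi, hv⟩
    · exact ⟨k, by omega, hFi, hv⟩

/-- The child is new, hence not an end of any earlier edge. So just after its attachment it is
covered if and only if its own edge is chosen, which is why child state `2` encodes that choice. -/
theorem IsGrowth.not_covered_child (hg : IsGrowth m c p) {F : ℕ → Prop} {k : ℕ} (hk : k < m) :
    ¬ Covered c p F k (c k) := by
  rintro ⟨i, hi, -, hv | hv⟩
  · exact hg.child_notMem k hk (hv ▸ child_mem c hi)
  · exact hg.child_notMem k hk (hv ▸ hg.parent_mem_of_lt hi hk.le)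

/-- Attaching edge `k` trades the single term `T (p k) (x (p k))` for an `attachCost`; everything
else agrees off `p k`. If the entry of `T` is attained by the chosen state, the partial cost stays
constant, and if the entry is only a lower bound, the partial cost cannot decrease. These are the
two uses of the identity. -/
theorem partialCost_succ (hg : IsGrowth m c p) {k : ℕ} (hk : k < m) {T T' : ℕ → ℕ → K}
    {F F' : ℕ → Prop} {x x' : ℕ → ℕ} (hT : ∀ v, v ≠ p k → T v = T' v)
    (hF : ∀ i < k, F' i ↔ F i) (hFk : F' k ↔ x' (c k) = 2)
    (hx : ∀ v ∈ prefixNodes c k, v ≠ p k → x' v = x v)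
    (hp : x' (p k) = if x' (c k) = 2 then 2 else x (p k))
    (h0 : x' (c k) = 2 → x (p k) ≠ 0) (h2 : x' (c k) ≤ 2) :
    partialCost c p w π T' F' x' (k + 1) + T (p k) (x (p k)) =
      partialCost c p w π T F x k +
        attachCost (T' (p k)) (T' (c k)) (w k) (π k) (x (p k)) (x' (c k)) := by
  classical
  -- The only possible change is that the parent moves to state `2`, and by `h0` it does not come
  -- from `0`. Hence no earlier penalty is affected.
  have hzero : ∀ v ∈ prefixNodes c k, x' v = 0 ↔ x v = 0 := by
    intro v hv
    by_cases h : v = p k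
    · subst h
      rw [hp]
      split_ifs with hc
      · simp [h0 hc]
      · rfl
    · rw [hx v hv h]
  have hpm := hg.parent_mem k hk
  have hcm := hg.child_notMem k hk
  have hrange : ∑ i ∈ range k,
      ((if F' i then w i else 0) + if x' (c i) = 0 ∧ x' (p i) = 0 then π i else 0) =
      ∑ i ∈ range k, ((if F i then w i else 0) + if x (c i) = 0 ∧ x (p i) = 0 then π i else 0) := by
    refine sum_congr rfl fun i hi => ?_
    have hi := mem_range.1 hi
    simp only [hF i hi, hzero _ (child_mem c hi), hzero _ (hg.parent_mem_of_lt hi hk.le)]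
  have hnodes : ∑ v ∈ (prefixNodes c k).erase (p k), T' v (x' v) =
      ∑ v ∈ (prefixNodes c k).erase (p k), T v (x v) := by
    refine sum_congr rfl fun v hv => ?_
    obtain ⟨h1, h2⟩ := mem_erase.1 hv
    rw [hx v h2 h1, hT v h1]
  unfold partialCost attachCost
  rw [prefixNodes_succ, sum_insert hcm, sum_range_succ, hrange, ← add_sum_erase _ _ hpm, hnodes,
    ← add_sum_erase (prefixNodes c k) (fun v => T v (x v)) hpm, hp]
  simp only [hFk]
  have hr : x' (c k) = 0 ∨ x' (c k) = 1 ∨ x' (c k) = 2 := by omega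
  rcases hr with hr | hr | hr
  · simp only [hr]
    by_cases hs : x (p k) = 0 <;> simp [hs] <;> abel
  · simp only [hr]
    simp
    abel
  · simp only [hr]
    simp
    abel

end cost

/-! ### Both bounds for the dynamic program -/

section optimality

variable {K : Type*} [AddCommGroup K] [LinearOrder K]

/-- The tables `T k` arise from `T m` by removing the attached nodes `m - 1, …, k`, and `D k s` is
an optimal state of the `k`-th attached node if its parent is in state `s`. -/
structure IsTableau (m l : ℕ) (c p : ℕ → ℕ) (w π : ℕ → K) (T : ℕ → ℕ → ℕ → K)
    (D : ℕ → ℕ → ℕ) : Prop where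
  of_ne : ∀ k, l ≤ k → k < m → ∀ v, v ≠ p k → T k v = T (k + 1) v
  choice_le : ∀ k, l ≤ k → k < m → ∀ s ≤ 2, D k s ≤ 2
  choice_valid : ∀ k, l ≤ k → k < m → ∀ s ≤ 2, D k s = 2 → s ≠ 0
  eq_choice : ∀ k, l ≤ k → k < m → ∀ s ≤ 2, T k (p k) s =
    attachCost (T (k + 1) (p k)) (T (k + 1) (c k)) (w k) (π k) s (D k s)
  le_attachCost : ∀ k, l ≤ k → k < m → ∀ s ≤ 2, ∀ r ≤ 2, (r = 2 → s ≠ 0) → T k (p k) s ≤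
    attachCost (T (k + 1) (p k)) (T (k + 1) (c k)) (w k) (π k) s r

/-- Node states `x` and an edge choice `F` on the first `k` attached nodes that extend an optimal
choice at the root optimally. -/
structure IsPartialSolution (c p : ℕ → ℕ) (w π : ℕ → K) (T : ℕ → ℕ → ℕ → K) (k : ℕ)
    (F : ℕ → Prop) (x : ℕ → ℕ) : Prop where
  le_two : ∀ v ∈ prefixNodes c k, x v ≤ 2
  eq_two_iff : ∀ v ∈ prefixNodes c k, x v = 2 ↔ Covered c p F k v
  cost_eq : partialCost c p w π (T k) F x k = min (T 0 0 0) (T 0 0 1)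

variable {m : ℕ} {c p : ℕ → ℕ} {w π nw : ℕ → K} {T : ℕ → ℕ → ℕ → K} {D : ℕ → ℕ → ℕ}

/-- Before any edge is considered nothing is covered, so only the root states `0` and `1` compete.
-/
theorem IsPartialSolution.zero {F : ℕ → Prop} {x : ℕ → ℕ}
    (hx : x 0 = if T 0 0 0 ≤ T 0 0 1 then 0 else 1) : IsPartialSolution c p w π T 0 F x := by
  refine ⟨?_, ?_, ?_⟩
  · simp only [prefixNodes_zero, mem_singleton, forall_eq, hx]
    split_ifs <;> omega
  · simp only [prefixNodes_zero, mem_singleton, forall_eq, hx, Covered]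
    split_ifs <;> simp
  · simp only [partialCost, prefixNodes_zero, sum_singleton, range_zero, sum_empty, add_zero, hx]
    split_ifs with h
    · rw [min_eq_left h]
    · rw [min_eq_right (not_le.1 h).le]

theorem IsPartialSolution.succ (hg : IsGrowth m c p) (hT : IsTableau m 0 c p w π T D) {k : ℕ}
    (hk : k < m) {F F' : ℕ → Prop} {x x' : ℕ → ℕ} (h : IsPartialSolution c p w π T k F x)
    (hF : ∀ i < k, F' i ↔ F i) (hFk : F' k ↔ D k (x (p k)) = 2)
    (hx : ∀ v ∈ prefixNodes c k, v ≠ p k → x' v = x v)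
    (hc : x' (c k) = D k (x (p k)))
    (hp : x' (p k) = if D k (x (p k)) = 2 then 2 else x (p k)) :
    IsPartialSolution c p w π T (k + 1) F' x' := by
  have hpm := hg.parent_mem k hk
  have hcm := hg.child_notMem k hk
  have hs := h.le_two _ hpm
  have hcov := covered_succ (c := c) (p := p) hF
  have hcc := hg.not_covered_child (F := F) hk
  have hD := hT.choice_le k (Nat.zero_le _) hk _ hs
  have hcp : c k ≠ p k := fun e => hcm (e ▸ hpm)
  refine ⟨?_, ?_, ?_⟩
  · rw [prefixNodes_succ]
    intro v hv
    rcases mem_insert.1 hv with rfl | hv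
    · rw [hc]; exact hD
    · by_cases hvp : v = p k
      · subst hvp
        rw [hp]
        split_ifs
        · exact le_rfl
        · exact hs
      · rw [hx v hv hvp]
        exact h.le_two v hv
  · rw [prefixNodes_succ]
    intro v hv
    rw [hcov]
    rcases mem_insert.1 hv with rfl | hv
    · simp [hc, hcc, hFk]
    · have hvc : v ≠ c k := fun e => hcm (e ▸ hv)
      by_cases hvp : v = p k
      · subst hvp
        rw [hp, ← h.eq_two_iff _ hv]
        simp only [or_true, and_true, hFk]
        split_ifs with h2 <;> simp [h2]
      · rw [hx v hv hvp, h.eq_two_iff v hv]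
        simp [hvc, hvp]
  · have key := partialCost_succ (w := w) (π := π) hg hk (hT.of_ne k (Nat.zero_le _) hk) hF
      (by rw [hFk, hc]) hx (by rw [hp, hc])
      (by rw [hc]; exact hT.choice_valid k (Nat.zero_le _) hk _ hs) (by rw [hc]; exact hD)
    -- The recorded decision attains the table entry, so `attachCost` cancels and the partial cost
    -- keeps its value.
    rw [hc, ← hT.eq_choice k (Nat.zero_le _) hk _ hs, add_left_inj] at key
    rw [key, h.cost_eq]

variable [IsOrderedAddMonoid K]

/-- An arbitrary `F` is given states with foresight: a node to be covered later waits in state `1`.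
The partial costs start at a root entry, increase weakly by the minimality of the tables, and end at
the true cost because no node is left in state `1` when all edges are present. -/
theorem min_le_coverCost (hg : IsGrowth m c p) (hT : IsTableau m 0 c p w π T D)
    (h0 : ∀ v ∈ prefixNodes c m, T m v 0 = 0) (h2 : ∀ v ∈ prefixNodes c m, T m v 2 = nw v)
    (F : ℕ → Prop) : min (T 0 0 0) (T 0 0 1) ≤ coverCost m c p w π nw F := by
  classical
  let x : ℕ → ℕ → ℕ := fun k v =>
    if Covered c p F k v then 2 else if Covered c p F m v then 1 else 0
  have hle : ∀ k v, x k v ≤ 2 := by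
    intro k v
    simp only [x]
    split_ifs <;> omega
  have hmono : ∀ k ≤ m, partialCost c p w π (T 0) F (x 0) 0 ≤
      partialCost c p w π (T k) F (x k) k := by
    intro k hk
    induction k with
    | zero => exact le_rfl
    | succ k ih =>
      have hkm : k < m := hk
      have hpm := hg.parent_mem k hkm
      have hcm := hg.child_notMem k hkm
      have hcov := covered_succ (c := c) (p := p) (k := k) (F := F) fun _ _ => Iff.rfl
      have hcc := hg.not_covered_child (F := F) hkm
      have hck : x (k + 1) (c k) = 2 ↔ F k := by
        simp only [x, hcov, hcc, true_or, and_true, false_or]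
        split_ifs <;> simp_all
      have hvalid : x (k + 1) (c k) = 2 → x k (p k) ≠ 0 := by
        rw [hck]
        intro hFk
        have : Covered c p F m (p k) := ⟨k, hkm, hFk, Or.inr rfl⟩
        simp only [x, this]
        split_ifs <;> omega
      have key := partialCost_succ (w := w) (π := π) (F := F) (F' := F) (x := x k)
        (x' := x (k + 1)) hg hkm (hT.of_ne k (Nat.zero_le _) hkm) (fun _ _ => Iff.rfl)
        hck.symm
        (by
          intro v hv hvp
          have hvc : v ≠ c k := fun e => hcm (e ▸ hv)
          simp only [x, hcov, hvc, hvp, or_self, and_false, or_false])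
        (by
          simp only [hck]
          simp only [x, hcov, or_true, and_true]
          by_cases hFk : F k <;> simp [hFk])
        hvalid (hle _ _)
      have hopt := hT.le_attachCost k (Nat.zero_le _) hkm _ (hle k (p k)) _ (hle (k + 1) (c k))
        hvalid
      refine (ih hkm.le).trans (le_of_add_le_add_right (a := T k (p k) (x k (p k))) ?_)
      rw [key]
      exact add_le_add_right hopt _
  have hstart : min (T 0 0 0) (T 0 0 1) ≤ partialCost c p w π (T 0) F (x 0) 0 := by
    have h : ¬ Covered c p F 0 0 := by simp [Covered]
    simp only [partialCost, prefixNodes_zero, sum_singleton, range_zero, sum_empty, add_zero, x, h,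
      if_false]
    split_ifs
    · exact min_le_right _ _
    · exact min_le_left _ _
  refine hstart.trans ((hmono m le_rfl).trans_eq ?_)
  unfold partialCost coverCost
  congr 1
  · refine sum_congr rfl fun v hv => ?_
    by_cases h : Covered c p F m v <;> simp [x, h, h0 v hv, h2 v hv]
  · refine sum_congr rfl fun i _ => ?_
    by_cases h : Covered c p F m (c i) <;> by_cases h' : Covered c p F m (p i) <;> simp [x, h, h']

/-- If no node ends in state `1`, states and coverage match and equality holds. Otherwise a single
such node has been charged the sum of all penalties, which covers whatever penalties are really
incurred. -/
theorem IsPartialSolution.coverCost_le (hg : IsGrowth m c p)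
    (hπ : ∀ i < m, 0 ≤ π i)
    (h0 : ∀ v ∈ prefixNodes c m, T m v 0 = 0)
    (h1 : ∀ v ∈ prefixNodes c m, T m v 1 = ∑ i ∈ range m, π i)
    (h2 : ∀ v ∈ prefixNodes c m, T m v 2 = nw v) {F : ℕ → Prop} {x : ℕ → ℕ}
    (h : IsPartialSolution c p w π T m F x) :
    coverCost m c p w π nw F ≤ min (T 0 0 0) (T 0 0 1) := by
  classical
  rw [← h.cost_eq]
  unfold partialCost coverCost
  have hP : 0 ≤ ∑ i ∈ range m, π i := sum_nonneg fun i hi => hπ i (mem_range.1 hi)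
  have hnode : ∀ v ∈ prefixNodes c m, T m v (x v) =
      (if Covered c p F m v then nw v else 0) + if x v = 1 then ∑ i ∈ range m, π i else 0 := by
    intro v hv
    have hle := h.le_two v hv
    rw [if_congr (h.eq_two_iff v hv).symm rfl rfl]
    have hr : x v = 0 ∨ x v = 1 ∨ x v = 2 := by omega
    rcases hr with hr | hr | hr <;> simp [hr, h0 v hv, h1 v hv, h2 v hv]
  by_cases hone : ∃ v ∈ prefixNodes c m, x v = 1
  · obtain ⟨v, hv, hxv⟩ := hone
    have hge : ∑ i ∈ range m, π i ≤
        ∑ v ∈ prefixNodes c m, if x v = 1 then ∑ i ∈ range m, π i else 0 := by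
      refine le_trans ?_ (single_le_sum (f := fun v => if x v = 1 then ∑ i ∈ range m, π i else 0)
        (fun u _ => ?_) hv)
      · simp [hxv]
      · split_ifs
        · exact hP
        · exact le_rfl
    rw [sum_congr rfl hnode, sum_add_distrib, sum_add_distrib, sum_add_distrib, add_assoc]
    refine add_le_add_right ?_ _
    rw [add_comm]
    refine add_le_add (le_trans (sum_le_sum fun i hi => ?_) hge) ?_
    · split_ifs
      · exact le_rfl
      · exact hπ i (mem_range.1 hi)
    · refine le_add_of_nonneg_right (sum_nonneg fun i hi => ?_)
      split_ifs
      · exact hπ i (mem_range.1 hi)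
      · exact le_rfl
  · push Not at hone
    refine le_of_eq ?_
    congr 1
    · refine sum_congr rfl fun v hv => ?_
      rw [hnode v hv, if_neg (hone v hv), add_zero]
    · refine sum_congr rfl fun i hi => ?_
      have hz : ∀ v ∈ prefixNodes c m, ¬ Covered c p F m v ↔ x v = 0 := by
        intro v hv
        rw [← h.eq_two_iff v hv]
        have := h.le_two v hv
        have := hone v hv
        omega
      have hi := mem_range.1 hi
      simp only [hz _ (child_mem c hi), hz _ (hg.parent_mem_of_lt hi le_rfl)]

end optimality

end TreeDP

/-! ### Reindexing edges and extending tableaux -/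

namespace TreeDP

theorem prefixNodes_congr {c c' : ℕ → ℕ} {k : ℕ} (h : ∀ i < k, c' i = c i) :
    prefixNodes c' k = prefixNodes c k := by
  ext v
  simp only [mem_prefixNodes]
  grind

theorem IsGrowth.congr {m : ℕ} {c p c' p' : ℕ → ℕ} (hg : IsGrowth m c p)
    (hc : ∀ i < m, c' i = c i) (hp : ∀ i < m, p' i = p i) : IsGrowth m c' p' := by
  constructor <;> intro i hi <;>
    rw [prefixNodes_congr fun j hj => hc j (hj.trans hi)]
  · rw [hp i hi]; exact hg.parent_mem i hi
  · rw [hc i hi]; exact hg.child_notMem i hi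

theorem IsGrowth.succ {k : ℕ} {c p : ℕ → ℕ} (hg : IsGrowth k c p) (hp : p k ∈ prefixNodes c k)
    (hc : c k ∉ prefixNodes c k) : IsGrowth (k + 1) c p := by
  constructor <;> intro i hi <;> rcases Nat.lt_succ_iff_lt_or_eq.1 hi with hi | rfl
  · exact hg.parent_mem i hi
  · exact hp
  · exact hg.child_notMem i hi
  · exact hc

/-- The edges of a growing tree are distinct. -/
theorem IsGrowth.injOn {m : ℕ} {c p idx u v : ℕ → ℕ} (hg : IsGrowth m c p)
    (h : ∀ i < m, s(c i, p i) = s(u (idx i), v (idx i))) :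
    Set.InjOn idx (Set.Iio m) := by
  -- If two attachments used the same listed edge, the later child would already be an end node of
  -- the earlier edge.
  have key : ∀ i j, i < j → j < m → idx i ≠ idx j := by
    intro i j hij hj e
    have e' : s(c i, p i) = s(c j, p j) := by rw [h i (hij.trans hj), h j hj, e]
    have hmem : c j ∈ s(c i, p i) := e' ▸ Sym2.mem_mk_left _ _
    rcases Sym2.mem_iff.1 hmem with e | e
    · exact hg.child_notMem j hj (e ▸ child_mem c hij)
    · exact hg.child_notMem j hj (e ▸ hg.parent_mem_of_lt hij hj.le)
  intro i hi j hj e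
  rcases lt_trichotomy i j with hij | hij | hij
  · exact (key i j hij hj e).elim
  · exact hij
  · exact (key j i hij hi e.symm).elim

theorem image_range_of_injOn {m : ℕ} {idx : ℕ → ℕ} (hinj : Set.InjOn idx (Set.Iio m))
    (hlt : ∀ i < m, idx i < m) : (Finset.range m).image idx = Finset.range m := by
  refine Finset.eq_of_subset_of_card_le ?_ ?_
  · intro j hj
    obtain ⟨i, hi, rfl⟩ := Finset.mem_image.1 hj
    exact Finset.mem_range.2 (hlt i (Finset.mem_range.1 hi))
  · rw [Finset.card_image_of_injOn (by simpa [Set.Iio] using hinj)]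

/-- The program sums the penalties in list order, the analysis in growth order. -/
theorem sum_comp_of_injOn {K : Type*} [AddCommMonoid K] {m : ℕ} {idx : ℕ → ℕ}
    (hinj : Set.InjOn idx (Set.Iio m)) (hlt : ∀ i < m, idx i < m) (f : ℕ → K) :
    ∑ i ∈ Finset.range m, f (idx i) = ∑ j ∈ Finset.range m, f j := by
  conv_rhs => rw [← image_range_of_injOn hinj hlt]
  rw [Finset.sum_image (by simpa [Set.Iio] using hinj)]

/-- The memory holds only the current table, so the family `T` of all tables lives in the proof
alone. One elimination extends it downwards by the new table `S` at index `k`. -/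
theorem IsTableau.extend {K : Type*} [AddCommGroup K] [LinearOrder K] {m k : ℕ} {c p : ℕ → ℕ}
    {w π : ℕ → K} {T : ℕ → ℕ → ℕ → K} {D D' : ℕ → ℕ → ℕ} (h : IsTableau m (k + 1) c p w π T D)
    {S : ℕ → ℕ → K} (hD : ∀ i, k < i → ∀ s ≤ 2, D' i s = D i s)
    (hne : ∀ v, v ≠ p k → S v = T (k + 1) v)
    (hle : ∀ s ≤ 2, D' k s ≤ 2) (hvalid : ∀ s ≤ 2, D' k s = 2 → s ≠ 0)
    (heq : ∀ s ≤ 2, S (p k) s =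
      attachCost (T (k + 1) (p k)) (T (k + 1) (c k)) (w k) (π k) s (D' k s))
    (hopt : ∀ s ≤ 2, ∀ r ≤ 2, (r = 2 → s ≠ 0) → S (p k) s ≤
      attachCost (T (k + 1) (p k)) (T (k + 1) (c k)) (w k) (π k) s r) :
    IsTableau m k c p w π (Function.update T k S) D' := by
  have hup : ∀ i, k < i → Function.update T k S i = T i := fun i hi =>
    Function.update_of_ne hi.ne' _ _
  constructor <;> intro i hki hi <;> rcases hki.eq_or_lt with rfl | hki
  · simpa [hup] using hne
  · rw [hup i hki, hup _ (by omega)]; exact h.of_ne i hki hi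
  · exact hle
  · intro s hs; rw [hD i hki s hs]; exact h.choice_le i hki hi s hs
  · exact hvalid
  · intro s hs; rw [hD i hki s hs]; exact h.choice_valid i hki hi s hs
  · simpa [hup] using heq
  · intro s hs; rw [hup i hki, hup _ (by omega), hD i hki s hs]; exact h.eq_choice i hki hi s hs
  · simpa [hup] using hopt
  · rw [hup i hki, hup _ (by omega)]; exact h.le_attachCost i hki hi

end TreeDP

/-! ### Reasoning about programs at unit cost -/

namespace RAM

/-- The number of elementary operations for evaluating a natural-number expression. -/
def NatExpr.size : NatExpr → ℕ
  | .const _ => 1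
  | .get _ i => i.size + 1
  | .add x y => x.size + y.size + 1
  | .sub x y => x.size + y.size + 1

/-- The number of elementary operations for evaluating a `K`-valued expression. -/
def NumExpr.size : NumExpr → ℕ
  | .zero => 1
  | .get _ i => i.size + 1
  | .add x y => x.size + y.size + 1
  | .sub x y => x.size + y.size + 1

/-- The number of elementary operations for evaluating a test. -/
def Test.size : Test → ℕ
  | .natLe x y => x.size + y.size + 1
  | .numLe x y => x.size + y.size + 1
  | .not b => b.size + 1
  | .and b d => b.size + d.size + 1

/-- A bound on the number of elementary operations of a program without loops. -/
def Program.size : Program → ℕ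
  | .skip => 1
  | .setNat _ i x => i.size + x.size + 1
  | .setNum _ i x => i.size + x.size + 1
  | .seq P Q => P.size + Q.size
  | .cond b P Q => b.size + 1 + max P.size Q.size
  | .loop _ _ => 0

/-- Programs without loops. -/
def Program.LoopFree : Program → Prop
  | .skip => True
  | .setNat _ _ _ => True
  | .setNum _ _ _ => True
  | .seq P Q => P.LoopFree ∧ Q.LoopFree
  | .cond _ P Q => P.LoopFree ∧ Q.LoopFree
  | .loop _ _ => False

section semantics

variable {K : Type*}

theorem NatExpr.time_unit (σ : State K) : ∀ e : NatExpr, e.time (unitCost K) σ = e.size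
  | .const _ => rfl
  | .get _ i => by rw [NatExpr.time, time_unit σ i]; rfl
  | .add x y => by rw [NatExpr.time, time_unit σ x, time_unit σ y]; rfl
  | .sub x y => by rw [NatExpr.time, time_unit σ x, time_unit σ y]; rfl

theorem State.setNat_nat (σ : State K) (a i x b j : ℕ) :
    (σ.setNat a i x).nat b j = if b = a ∧ j = i then x else σ.nat b j := by
  simp only [State.setNat, Function.update_apply]
  split_ifs <;> simp_all

theorem State.setNat_num (σ : State K) (a i x : ℕ) : (σ.setNat a i x).num = σ.num := rfl

theorem State.setNum_num (σ : State K) (a i : ℕ) (x : K) (b j : ℕ) :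
    (σ.setNum a i x).num b j = if b = a ∧ j = i then x else σ.num b j := by
  simp only [State.setNum, Function.update_apply]
  split_ifs <;> simp_all

theorem State.setNum_nat (σ : State K) (a i : ℕ) (x : K) : (σ.setNum a i x).nat = σ.nat := rfl

variable [AddCommGroup K]

theorem NumExpr.time_unit (σ : State K) : ∀ e : NumExpr, e.time (unitCost K) σ = e.size
  | .zero => rfl
  | .get _ i => by rw [NumExpr.time, NatExpr.time_unit σ i]; rfl
  | .add x y => by rw [NumExpr.time, time_unit σ x, time_unit σ y]; rfl
  | .sub x y => by rw [NumExpr.time, time_unit σ x, time_unit σ y]; rfl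

theorem Test.time_unit (σ : State K) : ∀ e : Test, e.time (unitCost K) σ = e.size
  | .natLe x y => by rw [Test.time, NatExpr.time_unit σ x, NatExpr.time_unit σ y]; rfl
  | .numLe x y => by rw [Test.time, NumExpr.time_unit σ x, NumExpr.time_unit σ y]; rfl
  | .not b => by rw [Test.time, time_unit σ b]; rfl
  | .and b d => by rw [Test.time, time_unit σ b, time_unit σ d]; rfl

variable [LinearOrder K]

open Classical in
/-- The effect of a program without loops. -/
noncomputable def Program.run : Program → State K → State K
  | .skip, σ => σ
  | .setNat a i x, σ => σ.setNat a (i.eval σ) (x.eval σ)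
  | .setNum a i x, σ => σ.setNum a (i.eval σ) (x.eval σ)
  | .seq P Q, σ => Q.run (P.run σ)
  | .cond b P Q, σ => if b.Holds σ then P.run σ else Q.run σ
  | .loop _ _, σ => σ

/-- Started with memory `σ`, the program `P` halts after at most `T` elementary operations with
memory satisfying `Q`. -/
def Halts (P : Program) (T : ℕ) (σ : State K) (Q : State K → Prop) : Prop :=
  ∃ t ≤ T, ∃ τ, Exec (unitCost K) P σ t τ ∧ Q τ

/-- Loop-free code is thereby replaced by the function `run`, which can be computed by
simplification; only loops need invariants. -/
theorem exec_run {P : Program} (hP : P.LoopFree) (σ : State K) :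
    Halts P P.size σ fun τ => τ = P.run σ := by
  induction P generalizing σ with
  | skip => exact ⟨1, le_rfl, _, .skip σ, rfl⟩
  | setNat a i x =>
    exact ⟨_, by rw [NatExpr.time_unit, NatExpr.time_unit]; rfl, _, .setNat σ a i x, rfl⟩
  | setNum a i x =>
    exact ⟨_, by rw [NatExpr.time_unit, NumExpr.time_unit]; rfl, _, .setNum σ a i x, rfl⟩
  | seq P Q ihP ihQ =>
    obtain ⟨s, hs, τ, hτ, rfl⟩ := ihP hP.1 σ
    obtain ⟨t, ht, ρ, hρ, rfl⟩ := ihQ hP.2 (P.run σ)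
    exact ⟨_, add_le_add hs ht, _, .seq hτ hρ, rfl⟩
  | cond b P Q ihP ihQ =>
    by_cases hb : b.Holds σ
    · obtain ⟨s, hs, τ, hτ, rfl⟩ := ihP hP.1 σ
      refine ⟨_, ?_, _, .condTrue hb hτ, by rw [Program.run, if_pos hb]⟩
      rw [Test.time_unit, Program.size]
      exact add_le_add_right (hs.trans (le_max_left _ _)) _
    · obtain ⟨s, hs, τ, hτ, rfl⟩ := ihQ hP.2 σ
      refine ⟨_, ?_, _, .condFalse hb hτ, by rw [Program.run, if_neg hb]⟩
      rw [Test.time_unit, Program.size]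
      exact add_le_add_right (hs.trans (le_max_right _ _)) _
  | loop => exact hP.elim

variable {P P' : Program} {T T' : ℕ} {σ : State K} {Q R : State K → Prop}

theorem Halts.of_run (hP : P.LoopFree) (h : Q (P.run σ)) : Halts P P.size σ Q := by
  obtain ⟨t, ht, τ, hτ, rfl⟩ := exec_run hP σ
  exact ⟨t, ht, _, hτ, h⟩

theorem Halts.mono (h : Halts P T σ Q) (hQ : ∀ τ, Q τ → R τ) : Halts P T σ R := by
  obtain ⟨t, ht, τ, hτ, hq⟩ := h
  exact ⟨t, ht, τ, hτ, hQ τ hq⟩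

theorem Halts.seq (h : Halts P T σ Q) (h' : ∀ τ, Q τ → Halts P' T' τ R) :
    Halts (.seq P P') (T + T') σ R := by
  obtain ⟨t, ht, τ, hτ, hq⟩ := h
  obtain ⟨s, hs, ρ, hρ, hr⟩ := h' τ hq
  exact ⟨_, add_le_add ht hs, ρ, .seq hτ hρ, hr⟩

/-- The invariant is indexed by the number of rounds done, which fixes the number of rounds at `N`.
The last summand pays for the failing test. -/
theorem Halts.loop {Inv : ℕ → State K → Prop} {b : Test} {N : ℕ}
    (step : ∀ i < N, ∀ σ, Inv i σ → b.Holds σ ∧ Halts P T σ (Inv (i + 1)))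
    (done : ∀ σ, Inv N σ → ¬ b.Holds σ) (h : Inv 0 σ) :
    Halts (.loop b P) (N * (b.size + 1 + T) + (b.size + 1)) σ (Inv N) := by
  have key : ∀ r ≤ N, ∀ σ, Inv (N - r) σ →
      Halts (.loop b P) (r * (b.size + 1 + T) + (b.size + 1)) σ (Inv N) := by
    intro r
    induction r with
    | zero =>
      intro _ σ hσ
      exact ⟨_, by rw [Test.time_unit]; omega, σ, .loopDone (done σ hσ), hσ⟩
    | succ r ih =>
      intro hr σ hσ
      obtain ⟨hb, t, ht, τ, hτ, hi⟩ := step (N - (r + 1)) (by omega) σ hσ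
      rw [show N - (r + 1) + 1 = N - r by omega] at hi
      obtain ⟨s, hs, ρ, hρ, hq⟩ := ih (by omega) τ hi
      refine ⟨_, ?_, ρ, .loopStep hb hτ hρ, hq⟩
      rw [Test.time_unit, add_mul, one_mul]
      omega
  exact key N le_rfl σ (by simpa using h)

end semantics

end RAM

namespace TreeDP

open RAM

/-! ### The program -/

section program

/-- The test `x < y`. -/
def ltTest (x y : NatExpr) : Test := .not (.natLe y x)

/-- A variable: entry `0` of the natural-number array `a`. -/
def var (a : ℕ) : NatExpr := .get a (.const 0)

/-- The number of edges. -/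
def numEdges : NatExpr := .get 0 (.const 1)

/-- Node, parent and edge of the current attachment step. -/
def curChild : NatExpr := .get 8 (var 4)
def curParent : NatExpr := .get 9 (var 4)
def curEdge : NatExpr := .get 10 (var 4)

/-- Adds one penalty to the entry of the root in array `3`. -/
def addPenalty : Program :=
  .seq (.setNum 3 (.const 0) (.add (.get 3 (.const 0)) (.get 2 (var 5))))
    (.setNat 5 (.const 0) (.add (var 5) (.const 1)))

/-- Stores the sum of all penalties in the entry of the root in array `3`. -/
def sumPenalties : Program := .loop (ltTest (var 5) numEdges) addPenalty

/-- Stores the edge under consideration if exactly one of its end nodes is marked. -/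
def testEdge : Program :=
  .seq
    (.cond (.and (.natLe (.get 7 (.get 1 (var 5))) (.get 7 (.get 2 (var 5))))
      (.natLe (.get 7 (.get 2 (var 5))) (.get 7 (.get 1 (var 5)))))
      .skip (.setNat 6 (.const 0) (var 5)))
    (.setNat 5 (.const 0) (.add (var 5) (.const 1)))

/-- Looks for an edge with exactly one marked end node. -/
def findEdge : Program :=
  .seq (.setNat 5 (.const 0) (.const 0)) (.loop (ltTest (var 5) numEdges) testEdge)

/-- Attaches the unmarked end node of the stored edge. -/
def attach : Program :=
  .seq
    (.cond (.natLe (.get 7 (.get 1 (var 6))) (.const 0))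
      (.seq (.setNat 8 (var 4) (.get 1 (var 6))) (.setNat 9 (var 4) (.get 2 (var 6))))
      (.seq (.setNat 8 (var 4) (.get 2 (var 6))) (.setNat 9 (var 4) (.get 1 (var 6)))))
    (.seq (.setNat 10 (var 4) (var 6))
      (.seq (.setNat 7 curChild (.const 1))
        (.seq (.setNum 3 curChild (.get 3 (.const 0)))
          -- The counter moves last because `curChild` is addressed through it.
          (.setNat 4 (.const 0) (.add (var 4) (.const 1))))))

/-- Attaches all nodes to the root `0`. -/
def grow : Program :=
  .seq (.setNat 7 (.const 0) (.const 1)) (.loop (ltTest (var 4) numEdges) (.seq findEdge attach))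

/-- Replaces the best known value by that of `e`, with decision `r`, if the latter is not larger. -/
def improve (d r : ℕ) (e : NumExpr) : Program :=
  .cond (.numLe e (.get 5 (.const 0)))
    (.seq (.setNum 5 (.const 0) e) (.setNat d (var 4) (.const r))) .skip

/-- Starts with the value of `e` and decision `0`. -/
def propose (d : ℕ) (e : NumExpr) : Program :=
  .seq (.setNum 5 (.const 0) e) (.setNat d (var 4) (.const 0))

/-- Updates the table of the parent for the state `0`. -/
def updateOut : Program :=
  .seq (propose 11 (.add (.add (.get 4 curChild) (.get 4 curParent)) (.get 2 curEdge)))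
    (.seq (improve 11 1 (.add (.get 3 curChild) (.get 4 curParent)))
      (.setNum 4 curParent (.get 5 (.const 0))))

/-- Updates the table of the parent for a state other than `0`, whose costs and decisions are in the
arrays `a` and `d`. -/
def updateIn (a d : ℕ) : Program :=
  .seq (propose d (.add (.get 4 curChild) (.get a curParent)))
    (.seq (improve d 1 (.add (.get 3 curChild) (.get a curParent)))
      (.seq (improve d 2 (.add (.add (.get 1 curEdge) (.get 0 curChild)) (.get 0 curParent)))
        (.setNum a curParent (.get 5 (.const 0)))))

/-- Removes the last attached node. -/
def eliminate : Program :=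
  .seq (.setNat 4 (.const 0) (.sub (var 4) (.const 1)))
    -- The tables are updated in place. The update for a parent state reads only the parent's
    -- entries for that state and for state `2`, so state `2` must come last.
    (.seq updateOut (.seq (updateIn 3 12) (updateIn 0 13)))

/-- Removes all nodes but the root. -/
def eliminateAll : Program := .loop (ltTest (.const 0) (var 4)) eliminate

/-- The state of the root. -/
def chooseRoot : Program :=
  .cond (.numLe (.get 4 (.const 0)) (.get 3 (.const 0))) (.setNat 14 (.const 0) (.const 0))
    (.setNat 14 (.const 0) (.const 1))

/-- Reads off the state of the next attached node, and whether its edge is chosen. -/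
def decideNext : Program :=
  .seq
    (.cond (.natLe (.get 14 curParent) (.const 0)) (.setNat 14 curChild (.get 11 (var 4)))
      (.cond (.natLe (.get 14 curParent) (.const 1)) (.setNat 14 curChild (.get 12 (var 4)))
        (.setNat 14 curChild (.get 13 (var 4)))))
    (.seq
      (.cond (.natLe (.const 2) (.get 14 curChild))
        (.seq (.setNat 14 curParent (.const 2)) (.setNat 3 curEdge (.const 1))) .skip)
      (.setNat 4 (.const 0) (.add (var 4) (.const 1))))

/-- Reads off an optimal solution. -/
def decideAll : Program := .seq chooseRoot (.loop (ltTest (var 4) numEdges) decideNext)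

/-- The algorithm for prize-collecting edge dominating sets in trees. -/
def algorithm : Program :=
  .seq sumPenalties (.seq grow (.seq eliminateAll decideAll))

end program

/-! ### One update of the tables -/

section correctness

variable {K : Type*}

/-- The memory represents the costs `T` of the states of the nodes. -/
def table (σ : State K) (v s : ℕ) : K :=
  if s = 0 then σ.num 4 v else if s = 1 then σ.num 3 v else σ.num 0 v

/-- The optimal states of the attached nodes that are stored in memory. -/
def decision (σ : State K) (k s : ℕ) : ℕ :=
  if s = 0 then σ.nat 11 k else if s = 1 then σ.nat 12 k else σ.nat 13 k

variable [AddCommGroup K] [LinearOrder K]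

/-- The edge weight `w` is free: it enters only if the edge is chosen, which a parent in state `0`
forbids. -/
theorem run_updateOut (σ : State K)
    {k c p e : ℕ} (hk : σ.nat 4 0 = k) (hc : σ.nat 8 k = c) (hp : σ.nat 9 k = p)
    (he : σ.nat 10 k = e) (w : K) :
    ∃ τ, updateOut.run σ = τ ∧
      (∀ b i, ¬ (b = 11 ∧ i = k) → τ.nat b i = σ.nat b i) ∧
      (∀ b i, ¬ (b = 4 ∧ i = p) → b ≠ 5 → τ.num b i = σ.num b i) ∧
      τ.nat 11 k ≤ 1 ∧
      τ.num 4 p = attachCost (table σ p) (table σ c) w (σ.num 2 e) 0 (τ.nat 11 k) ∧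
      ∀ r ≤ 1, τ.num 4 p ≤ attachCost (table σ p) (table σ c) w (σ.num 2 e) 0 r := by
  subst hk hc hp he
  refine ⟨_, rfl, ?_⟩
  by_cases h : σ.num 3 (σ.nat 8 (σ.nat 4 0)) + σ.num 4 (σ.nat 9 (σ.nat 4 0)) ≤
    σ.num 4 (σ.nat 8 (σ.nat 4 0)) + σ.num 4 (σ.nat 9 (σ.nat 4 0)) +
      σ.num 2 (σ.nat 10 (σ.nat 4 0))
  all_goals
    simp [updateOut, propose, improve, Program.run, NatExpr.eval, NumExpr.eval, Test.Holds, var,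
      curChild, curParent, curEdge, State.setNat_nat, State.setNat_num, State.setNum_nat,
      State.setNum_num, h, table, attachCost]
    refine ⟨by grind, by grind, ?_⟩
    intro r hr
    interval_cases r <;> simp_all <;> grind

/-- The penalty `π` is free, since a parent in state `1` or `2` counts as covered and dominates the
edge. The case split follows the two comparisons made by the program. -/
theorem run_updateIn (σ : State K) {a d s : ℕ} (hs : s = 1 ∧ a = 3 ∧ d = 12 ∨ s = 2 ∧ a = 0 ∧ d = 13)
    {k c p e : ℕ} (hk : σ.nat 4 0 = k) (hc : σ.nat 8 k = c) (hp : σ.nat 9 k = p)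
    (he : σ.nat 10 k = e) (π : K) :
    ∃ τ, (updateIn a d).run σ = τ ∧
      (∀ b i, ¬ (b = d ∧ i = k) → τ.nat b i = σ.nat b i) ∧
      (∀ b i, ¬ (b = a ∧ i = p) → b ≠ 5 → τ.num b i = σ.num b i) ∧
      τ.nat d k ≤ 2 ∧
      τ.num a p = attachCost (table σ p) (table σ c) (σ.num 1 e) π s (τ.nat d k) ∧
      ∀ r ≤ 2, τ.num a p ≤ attachCost (table σ p) (table σ c) (σ.num 1 e) π s r := by
  subst hk hc hp he
  refine ⟨_, rfl, ?_⟩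
  set k := σ.nat 4 0
  set c := σ.nat 8 k
  set p := σ.nat 9 k
  set e := σ.nat 10 k
  rcases hs with ⟨rfl, rfl, rfl⟩ | ⟨rfl, rfl, rfl⟩
  · by_cases h1 : σ.num 3 c + σ.num 3 p ≤ σ.num 4 c + σ.num 3 p
    · by_cases h2 : σ.num 1 e + σ.num 0 c + σ.num 0 p ≤ σ.num 3 c + σ.num 3 p
      all_goals
        simp [updateIn, propose, improve, Program.run, NatExpr.eval, NumExpr.eval, Test.Holds, var,
          curChild, curParent, curEdge, State.setNat_nat, State.setNat_num, State.setNum_nat,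
          State.setNum_num, h1, h2, table, attachCost, k, c, p, e]
        refine ⟨by grind, by grind, ?_⟩
        intro r hr
        interval_cases r <;> simp_all <;> grind
    · by_cases h2 : σ.num 1 e + σ.num 0 c + σ.num 0 p ≤ σ.num 4 c + σ.num 3 p
      all_goals
        simp [updateIn, propose, improve, Program.run, NatExpr.eval, NumExpr.eval, Test.Holds, var,
          curChild, curParent, curEdge, State.setNat_nat, State.setNat_num, State.setNum_nat,
          State.setNum_num, h1, h2, table, attachCost, k, c, p, e]
        refine ⟨by grind, by grind, ?_⟩
        intro r hr
        interval_cases r <;> simp_all <;> grind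
  · by_cases h1 : σ.num 3 c + σ.num 0 p ≤ σ.num 4 c + σ.num 0 p
    · by_cases h2 : σ.num 1 e + σ.num 0 c + σ.num 0 p ≤ σ.num 3 c + σ.num 0 p
      all_goals
        simp [updateIn, propose, improve, Program.run, NatExpr.eval, NumExpr.eval, Test.Holds, var,
          curChild, curParent, curEdge, State.setNat_nat, State.setNat_num, State.setNum_nat,
          State.setNum_num, h1, h2, table, attachCost, k, c, p, e]
        refine ⟨by grind, by grind, ?_⟩
        intro r hr
        interval_cases r <;> simp_all <;> grind
    · by_cases h2 : σ.num 1 e + σ.num 0 c + σ.num 0 p ≤ σ.num 4 c + σ.num 0 p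
      all_goals
        simp [updateIn, propose, improve, Program.run, NatExpr.eval, NumExpr.eval, Test.Holds, var,
          curChild, curParent, curEdge, State.setNat_nat, State.setNat_num, State.setNum_nat,
          State.setNum_num, h1, h2, table, attachCost, k, c, p, e]
        refine ⟨by grind, by grind, ?_⟩
        intro r hr
        interval_cases r <;> simp_all <;> grind

end correctness

end TreeDP

namespace TreeDP

open RAM

/-! ### Elimination of leaves and reading off the solution -/

section correctness

variable {K : Type*} [AddCommGroup K]

/-- Of the parent's table only the entries `s` and `2` matter, which justifies updating in place. -/
theorem attachCost_congr {tp tp' tc tc' : ℕ → K} {w π : K} {s r : ℕ} (hc : ∀ i, tc i = tc' i)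
    (hs : tp s = tp' s) (h2 : tp 2 = tp' 2) :
    attachCost tp tc w π s r = attachCost tp' tc' w π s r := by
  simp only [attachCost, hc, hs, h2]

variable [LinearOrder K]

/-- The memory while nodes are removed, when `k` nodes besides the root are left. -/
structure EliminateInv (m : ℕ) (c p idx : ℕ → ℕ) (w π : ℕ → K) (T₀ : ℕ → ℕ → K) (k : ℕ)
    (σ : State K) : Prop where
  counter : σ.nat 4 0 = k
  numEdges : σ.nat 0 1 = m
  child : ∀ i, σ.nat 8 i = c i
  parent : ∀ i, σ.nat 9 i = p i
  edge : ∀ i, σ.nat 10 i = idx i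
  out : ∀ i, σ.nat 3 i = 0
  weight : ∀ i, σ.num 1 i = w i
  penalty : ∀ i, σ.num 2 i = π i
  tableau : ∃ T : ℕ → ℕ → ℕ → K, T m = T₀ ∧ T k = table σ ∧
    IsTableau m k c p (fun i => w (idx i)) (fun i => π (idx i)) T (decision σ)

variable {m k : ℕ} {c p idx : ℕ → ℕ} {w π : ℕ → K} {T₀ : ℕ → ℕ → K} {σ : State K}

theorem EliminateInv.step (h : EliminateInv m c p idx w π T₀ (k + 1) σ) (hk : k < m)
    (hcp : c k ≠ p k) : EliminateInv m c p idx w π T₀ k (eliminate.run σ) := by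
  obtain ⟨T, hTm, hTk, hT⟩ := h.tableau
  have hσ₀ : ∃ σ₀, σ₀ = σ.setNat 4 0 k ∧ eliminate.run σ =
      (updateIn 0 13).run ((updateIn 3 12).run (updateOut.run σ₀)) := by
    refine ⟨_, rfl, ?_⟩
    simp [eliminate, Program.run, NatExpr.eval, var, h.counter]
  obtain ⟨σ₀, e₀, hrun⟩ := hσ₀
  have n₀ : ∀ b i, b ≠ 4 → σ₀.nat b i = σ.nat b i := by
    intro b i hb
    simp [e₀, State.setNat_nat, hb]
  have c₀ : σ₀.nat 4 0 = k := by simp [e₀, State.setNat_nat]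
  have m₀ : σ₀.num = σ.num := by rw [e₀, State.setNat_num]
  obtain ⟨σ₁, r₁, n₁, m₁, d₁, q₁, o₁⟩ := run_updateOut σ₀ (c := c k) (p := p k) (e := idx k) c₀
    (by rw [n₀ _ _ (by norm_num), h.child]) (by rw [n₀ _ _ (by norm_num), h.parent])
    (by rw [n₀ _ _ (by norm_num), h.edge]) (w (idx k))
  obtain ⟨σ₂, r₂, n₂, m₂, d₂, q₂, o₂⟩ := run_updateIn σ₁ (s := 1) (a := 3) (d := 12) (by simp)
    (k := k) (c := c k) (p := p k) (e := idx k)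
    (by rw [n₁ _ _ (by norm_num), c₀])
    (by rw [n₁ _ _ (by norm_num), n₀ _ _ (by norm_num), h.child])
    (by rw [n₁ _ _ (by norm_num), n₀ _ _ (by norm_num), h.parent])
    (by rw [n₁ _ _ (by norm_num), n₀ _ _ (by norm_num), h.edge]) (π (idx k))
  obtain ⟨σ₃, r₃, n₃, m₃, d₃, q₃, o₃⟩ := run_updateIn σ₂ (s := 2) (a := 0) (d := 13) (by simp)
    (k := k) (c := c k) (p := p k) (e := idx k)
    (by rw [n₂ _ _ (by norm_num), n₁ _ _ (by norm_num), c₀])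
    (by rw [n₂ _ _ (by norm_num), n₁ _ _ (by norm_num), n₀ _ _ (by norm_num), h.child])
    (by rw [n₂ _ _ (by norm_num), n₁ _ _ (by norm_num), n₀ _ _ (by norm_num), h.parent])
    (by rw [n₂ _ _ (by norm_num), n₁ _ _ (by norm_num), n₀ _ _ (by norm_num), h.edge]) (π (idx k))
  rw [hrun, r₁, r₂, r₃]
  have hn : ∀ b i, b ≠ 4 → b < 11 → σ₃.nat b i = σ.nat b i := by
    intro b i h4 hb
    rw [n₃ _ _ (by omega), n₂ _ _ (by omega), n₁ _ _ (by omega), n₀ _ _ h4]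
  have hm : ∀ b i, b = 1 ∨ b = 2 → σ₃.num b i = σ.num b i := by
    intro b i hb
    rw [m₃ _ _ (by omega) (by omega), m₂ _ _ (by omega) (by omega), m₁ _ _ (by omega) (by omega),
      m₀]
  -- Each intermediate memory still shows the old table except at the parent's entries overwritten
  -- so far; the child's entries survive because `c k ≠ p k`.
  have t₁ : ∀ v s, ¬ (s = 0 ∧ v = p k) → table σ₁ v s = T (k + 1) v s := by
    intro v s hvs
    simp only [hTk, table, ← m₀]
    rw [m₁ 3 _ (by omega) (by omega), m₁ 0 _ (by omega) (by omega)]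
    split_ifs with hs
    · exact m₁ 4 _ (by tauto) (by omega)
    · rfl
    · rfl
  have t₂ : ∀ v s, ¬ (s = 0 ∧ v = p k) → ¬ (s = 1 ∧ v = p k) → table σ₂ v s = T (k + 1) v s := by
    intro v s hvs hvs'
    rw [← t₁ v s hvs]
    simp only [table]
    rw [m₂ 4 _ (by omega) (by omega), m₂ 0 _ (by omega) (by omega)]
    split_ifs with hs hs'
    · rfl
    · exact m₂ 3 _ (by tauto) (by omega)
    · rfl
  have t₃ : ∀ v, v ≠ p k → table σ₃ v = T (k + 1) v := by
    intro v hv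
    funext s
    rw [← t₂ v s (by tauto) (by tauto)]
    simp only [table]
    rw [m₃ 4 _ (by omega) (by omega), m₃ 3 _ (by omega) (by omega), m₃ 0 _ (by tauto) (by omega)]
  have v₀ : table σ₃ (p k) 0 = σ₁.num 4 (p k) := by
    simp only [table, if_true]
    rw [m₃ _ _ (by omega) (by omega), m₂ _ _ (by omega) (by omega)]
  have v₁ : table σ₃ (p k) 1 = σ₂.num 3 (p k) := by
    simp [table]
    rw [m₃ _ _ (by omega) (by omega)]
  have v₂ : table σ₃ (p k) 2 = σ₃.num 0 (p k) := by simp [table]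
  have w₀ : decision σ₃ k 0 = σ₁.nat 11 k := by
    simp only [decision, if_true]
    rw [n₃ _ _ (by omega), n₂ _ _ (by omega)]
  have w₁ : decision σ₃ k 1 = σ₂.nat 12 k := by
    simp [decision]
    rw [n₃ _ _ (by omega)]
  have w₂ : decision σ₃ k 2 = σ₃.nat 13 k := by simp [decision]
  have p₁ : σ₀.num 2 (idx k) = π (idx k) := by rw [m₀, h.penalty]
  have p₂ : σ₁.num 1 (idx k) = w (idx k) := by rw [m₁ _ _ (by omega) (by omega), m₀, h.weight]
  have p₃ : σ₂.num 1 (idx k) = w (idx k) := by rw [m₂ _ _ (by omega) (by omega), p₂]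
  have a₁ : ∀ r, attachCost (table σ₀ (p k)) (table σ₀ (c k)) (w (idx k)) (π (idx k)) 0 r =
      attachCost (T (k + 1) (p k)) (T (k + 1) (c k)) (w (idx k)) (π (idx k)) 0 r := by
    intro r
    have ht : table σ₀ = table σ := by
      funext v s
      simp only [table, m₀]
    rw [ht, hTk]
  have a₂ : ∀ r, attachCost (table σ₁ (p k)) (table σ₁ (c k)) (w (idx k)) (π (idx k)) 1 r =
      attachCost (T (k + 1) (p k)) (T (k + 1) (c k)) (w (idx k)) (π (idx k)) 1 r := fun r =>
    attachCost_congr (fun i => t₁ _ _ (by tauto)) (t₁ _ _ (by omega)) (t₁ _ _ (by omega))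
  have a₃ : ∀ r, attachCost (table σ₂ (p k)) (table σ₂ (c k)) (w (idx k)) (π (idx k)) 2 r =
      attachCost (T (k + 1) (p k)) (T (k + 1) (c k)) (w (idx k)) (π (idx k)) 2 r := fun r =>
    attachCost_congr (fun i => t₂ _ _ (by tauto) (by tauto)) (t₂ _ _ (by omega) (by omega))
      (t₂ _ _ (by omega) (by omega))
  rw [p₁] at q₁ o₁
  rw [p₂] at q₂ o₂
  rw [p₃] at q₃ o₃
  simp only [a₁] at q₁ o₁
  simp only [a₂] at q₂ o₂
  simp only [a₃] at q₃ o₃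
  have hcases : ∀ s ≤ 2, s = 0 ∨ s = 1 ∨ s = 2 := by omega
  refine ⟨?_, ?_, ?_, ?_, ?_, ?_, ?_, ?_, Function.update T k (table σ₃), ?_, ?_, ?_⟩
  · rw [n₃ _ _ (by omega), n₂ _ _ (by omega), n₁ _ _ (by omega), c₀]
  · rw [hn _ _ (by omega) (by omega), h.numEdges]
  · intro i; rw [hn _ _ (by omega) (by omega), h.child]
  · intro i; rw [hn _ _ (by omega) (by omega), h.parent]
  · intro i; rw [hn _ _ (by omega) (by omega), h.edge]
  · intro i; rw [hn _ _ (by omega) (by omega), h.out]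
  · intro i; rw [hm _ _ (by omega), h.weight]
  · intro i; rw [hm _ _ (by omega), h.penalty]
  · rw [Function.update_of_ne hk.ne', hTm]
  · rw [Function.update_self]
  · refine hT.extend (D' := decision σ₃) ?_ t₃ ?_ ?_ ?_ ?_
    · intro i hi s _
      simp only [decision]
      rw [n₃ 11 _ (by omega), n₂ 11 _ (by omega), n₁ 11 _ (by omega), n₀ _ _ (by omega),
        n₃ 12 _ (by omega), n₂ 12 _ (by omega), n₁ 12 _ (by omega), n₀ _ _ (by omega),
        n₃ 13 _ (by omega), n₂ 13 _ (by omega), n₁ 13 _ (by omega), n₀ _ _ (by omega)]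
    · intro s hs
      rcases hcases s hs with rfl | rfl | rfl
      · rw [w₀]; omega
      · rw [w₁]; exact d₂
      · rw [w₂]; exact d₃
    · intro s hs
      rcases hcases s hs with rfl | rfl | rfl
      · rw [w₀]; omega
      · omega
      · omega
    · intro s hs
      rcases hcases s hs with rfl | rfl | rfl
      · rw [w₀, v₀, q₁]
      · rw [w₁, v₁, q₂]
      · rw [w₂, v₂, q₃]
    · intro s hs r hr hrs
      rcases hcases s hs with rfl | rfl | rfl
      · rw [v₀]; exact o₁ r (by omega)
      · rw [v₁]; exact o₂ r hr
      · rw [v₂]; exact o₃ r hr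

theorem halts_eliminateAll (hcp : ∀ i < m, c i ≠ p i) (h : EliminateInv m c p idx w π T₀ m σ) :
    Halts eliminateAll (m * ((ltTest (.const 0) (var 4)).size + 1 + eliminate.size) +
      ((ltTest (.const 0) (var 4)).size + 1)) σ (EliminateInv m c p idx w π T₀ 0) := by
  have := Halts.loop (P := eliminate) (T := eliminate.size) (σ := σ) (N := m)
    (b := ltTest (.const 0) (var 4))
    -- The counter runs down, whereas `Halts.loop` counts completed rounds.
    (Inv := fun i => EliminateInv m c p idx w π T₀ (m - i)) ?_ ?_ (by simpa using h)
  · simpa [eliminateAll] using this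
  · intro i hi τ hτ
    rw [show m - i = m - (i + 1) + 1 by omega] at hτ
    refine ⟨?_, Halts.of_run (by simp [eliminate, updateOut, updateIn, propose, improve,
      Program.LoopFree]) (hτ.step (by omega) (hcp _ (by omega)))⟩
    simp [ltTest, Test.Holds, NatExpr.eval, var, hτ.counter]
  · intro τ hτ
    simp [ltTest, Test.Holds, NatExpr.eval, var, hτ.counter]

/-- The memory while the solution is read off, when it is known for the first `k` attached nodes. -/
structure DecideInv (m : ℕ) (c p idx : ℕ → ℕ) (w π : ℕ → K) (T : ℕ → ℕ → ℕ → K)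
    (D : ℕ → ℕ → ℕ) (k : ℕ) (σ : State K) : Prop where
  counter : σ.nat 4 0 = k
  numEdges : σ.nat 0 1 = m
  child : ∀ i, σ.nat 8 i = c i
  parent : ∀ i, σ.nat 9 i = p i
  edge : ∀ i, σ.nat 10 i = idx i
  decision_eq : decision σ = D
  out : ∀ i, k ≤ i → i < m → σ.nat 3 (idx i) = 0
  solution : IsPartialSolution c p (fun i => w (idx i)) (fun i => π (idx i)) T k
    (fun i => σ.nat 3 (idx i) = 1) (σ.nat 14)

theorem run_decideNext (σ : State K) {k c p e r : ℕ} (hk : σ.nat 4 0 = k) (hc : σ.nat 8 k = c)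
    (hp : σ.nat 9 k = p) (he : σ.nat 10 k = e) (hx : σ.nat 14 p ≤ 2)
    (hr : decision σ k (σ.nat 14 p) = r) (hr2 : r ≤ 2) (hcp : c ≠ p) :
    ∃ τ, decideNext.run σ = τ ∧ τ.nat 4 0 = k + 1 ∧
      (∀ b i, b ≠ 3 → b ≠ 4 → b ≠ 14 → τ.nat b i = σ.nat b i) ∧
      (∀ i, τ.nat 14 i = if i = p then (if r = 2 then 2 else σ.nat 14 p)
        else if i = c then r else σ.nat 14 i) ∧
      ∀ i, τ.nat 3 i = if r = 2 ∧ i = e then 1 else σ.nat 3 i := by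
  refine ⟨_, rfl, ?_⟩
  have hcases : σ.nat 14 p = 0 ∨ σ.nat 14 p = 1 ∨ σ.nat 14 p = 2 := by omega
  by_cases h2 : r = 2
  · subst h2
    rcases hcases with h | h | h <;> simp only [decision, h] at hr <;>
      simp [decideNext, Program.run, NatExpr.eval, Test.Holds, var, curChild, curParent,
        curEdge, State.setNat_nat, hk, hc, hp, he, h] at hr ⊢ <;>
      grind [State.setNat_nat]
  · have h2' : ¬ 2 ≤ r := by omega
    rcases hcases with h | h | h <;> simp only [decision, h] at hr <;>
      simp [decideNext, Program.run, NatExpr.eval, Test.Holds, var, curChild, curParent,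
        curEdge, State.setNat_nat, hk, hc, hp, he, h] at hr ⊢ <;>
      grind [State.setNat_nat]

variable {T : ℕ → ℕ → ℕ → K} {D : ℕ → ℕ → ℕ}

theorem DecideInv.step (hg : IsGrowth m c p) (hidx : Set.InjOn idx (Set.Iio m))
    (hT : IsTableau m 0 c p (fun i => w (idx i)) (fun i => π (idx i)) T D)
    (h : DecideInv m c p idx w π T D k σ) (hk : k < m) :
    DecideInv m c p idx w π T D (k + 1) (decideNext.run σ) := by
  have hpm := hg.parent_mem k hk
  have hcm := hg.child_notMem k hk
  have hcp : c k ≠ p k := fun e => hcm (e ▸ hpm)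
  have hx := h.solution.le_two _ hpm
  have hD := hT.choice_le k (Nat.zero_le _) hk _ hx
  obtain ⟨τ, hτ, h4, hn, h14, h3⟩ := run_decideNext σ h.counter (h.child k) (h.parent k) (h.edge k)
    hx (by rw [h.decision_eq]) hD hcp
  rw [hτ]
  -- Distinct attachments use distinct listed edges, so writing the output for edge `k` leaves the
  -- other decisions alone.
  have hne : ∀ i < m, i ≠ k → idx i ≠ idx k := fun i hi hik e => hik (hidx hi hk e)
  refine ⟨h4, ?_, ?_, ?_, ?_, ?_, ?_, ?_⟩
  · rw [hn _ _ (by omega) (by omega) (by omega), h.numEdges]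
  · intro i; rw [hn _ _ (by omega) (by omega) (by omega), h.child]
  · intro i; rw [hn _ _ (by omega) (by omega) (by omega), h.parent]
  · intro i; rw [hn _ _ (by omega) (by omega) (by omega), h.edge]
  · rw [← h.decision_eq]
    funext i s
    simp only [decision]
    rw [hn 11 _ (by omega) (by omega) (by omega), hn 12 _ (by omega) (by omega) (by omega),
      hn 13 _ (by omega) (by omega) (by omega)]
  · intro i hki hi
    rw [h3, if_neg (by simp [hne i hi (by omega)]), h.out i (by omega) hi]
  · refine h.solution.succ hg hT hk ?_ ?_ ?_ ?_ ?_
    · intro i hi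
      simp only [h3, hne i (hi.trans hk) hi.ne, and_false, if_false]
    · have := h.out k le_rfl hk
      simp only [h3, and_true, this]
      split_ifs with h2 <;> simp [h2]
    · intro v hv hvp
      have hvc : v ≠ c k := fun e => hcm (e ▸ hv)
      simp [h14, hvp, hvc]
    · simp [h14, hcp]
    · simp [h14]

theorem halts_decideAll (hg : IsGrowth m c p) (hidx : Set.InjOn idx (Set.Iio m))
    (hT : IsTableau m 0 c p (fun i => w (idx i)) (fun i => π (idx i)) T (decision σ))
    (hT0 : T 0 = table σ) (h : EliminateInv m c p idx w π T₀ 0 σ) :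
    Halts decideAll (chooseRoot.size + (m * ((ltTest (var 4) numEdges).size + 1 + decideNext.size) +
      ((ltTest (var 4) numEdges).size + 1))) σ
      (DecideInv m c p idx w π T (decision σ) m) := by
  refine Halts.seq (Q := DecideInv m c p idx w π T (decision σ) 0) (Halts.of_run ?_ ?_) ?_
  · simp [chooseRoot, Program.LoopFree]
  · have hrun : chooseRoot.run σ =
        σ.setNat 14 0 (if T 0 0 0 ≤ T 0 0 1 then 0 else 1) := by
      simp only [chooseRoot, Program.run, Test.Holds, NumExpr.eval, NatExpr.eval, hT0]
      by_cases hle : σ.num 4 0 ≤ σ.num 3 0 <;> simp [table, hle]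
    rw [hrun]
    refine ⟨?_, ?_, ?_, ?_, ?_, ?_, ?_, ?_⟩
    · simp [State.setNat_nat, h.counter]
    · simp [State.setNat_nat, h.numEdges]
    · simp [State.setNat_nat, h.child]
    · simp [State.setNat_nat, h.parent]
    · simp [State.setNat_nat, h.edge]
    · funext i s
      simp [decision, State.setNat_nat]
    · simp [State.setNat_nat, h.out]
    · exact IsPartialSolution.zero (by simp [State.setNat_nat])
  · intro τ hτ
    refine Halts.loop ?_ ?_ hτ
    · intro i hi ρ hρ
      refine ⟨?_, Halts.of_run (by simp [decideNext, Program.LoopFree]) (hρ.step hg hidx hT hi)⟩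
      simp [ltTest, Test.Holds, NatExpr.eval, var, numEdges, hρ.counter, hρ.numEdges, hi]
    · intro ρ hρ
      simp [ltTest, Test.Holds, NatExpr.eval, var, numEdges, hρ.counter, hρ.numEdges]

end correctness

end TreeDP

namespace TreeDP

open RAM

/-! ### The growing phase and the whole algorithm -/

section correctness

variable {K : Type*} [AddCommGroup K] [LinearOrder K]

/-- The initial memory for a graph with `m` edges from `u j` to `v j`. -/
structure IsInput (m : ℕ) (u v : ℕ → ℕ) (nw w π : ℕ → K) (σ : State K) : Prop where
  numEdges : σ.nat 0 1 = m
  left : ∀ i, σ.nat 1 i = u i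
  right : ∀ i, σ.nat 2 i = v i
  nat_zero : ∀ b i, 3 ≤ b → σ.nat b i = 0
  nodeWeight : ∀ i, σ.num 0 i = nw i
  weight : ∀ i, σ.num 1 i = w i
  penalty : ∀ i, σ.num 2 i = π i
  num_zero : ∀ b i, 3 ≤ b → σ.num b i = 0

/-- The memory when `k` nodes have been attached to the root. -/
structure GrowInv (m : ℕ) (u v : ℕ → ℕ) (nw w π : ℕ → K) (k : ℕ) (σ : State K) : Prop where
  counter : σ.nat 4 0 = k
  numEdges : σ.nat 0 1 = m
  left : ∀ i, σ.nat 1 i = u i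
  right : ∀ i, σ.nat 2 i = v i
  out : ∀ i, σ.nat 3 i = 0
  nodeWeight : ∀ i, σ.num 0 i = nw i
  weight : ∀ i, σ.num 1 i = w i
  penalty : ∀ i, σ.num 2 i = π i
  cost_out : ∀ i, σ.num 4 i = 0
  cost_unpaid : ∀ x ∈ prefixNodes (σ.nat 8) k, σ.num 3 x = ∑ j ∈ Finset.range m, π j
  mark : ∀ x, σ.nat 7 x = if x ∈ prefixNodes (σ.nat 8) k then 1 else 0
  growth : IsGrowth k (σ.nat 8) (σ.nat 9)
  edge_lt : ∀ i < k, σ.nat 10 i < m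
  edge : ∀ i < k, s(σ.nat 8 i, σ.nat 9 i) = s(u (σ.nat 10 i), v (σ.nat 10 i))

variable {m k : ℕ} {u v : ℕ → ℕ} {nw w π : ℕ → K} {σ : State K}

theorem halts_sumPenalties (h : IsInput m u v nw w π σ) :
    Halts sumPenalties (m * ((ltTest (var 5) numEdges).size + 1 + addPenalty.size) +
      ((ltTest (var 5) numEdges).size + 1)) σ fun τ =>
        (∀ b i, b ≠ 5 → τ.nat b i = σ.nat b i) ∧
        (∀ b i, ¬ (b = 3 ∧ i = 0) → τ.num b i = σ.num b i) ∧
        τ.num 3 0 = ∑ j ∈ Finset.range m, π j := by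
  refine Halts.mono (Q := fun τ => τ.nat 5 0 = m ∧ (∀ b i, b ≠ 5 → τ.nat b i = σ.nat b i) ∧
    (∀ b i, ¬ (b = 3 ∧ i = 0) → τ.num b i = σ.num b i) ∧
    τ.num 3 0 = ∑ j ∈ Finset.range m, π j) ?_ fun τ hτ => hτ.2
  refine Halts.loop (Inv := fun k τ => τ.nat 5 0 = k ∧ (∀ b i, b ≠ 5 → τ.nat b i = σ.nat b i) ∧
    (∀ b i, ¬ (b = 3 ∧ i = 0) → τ.num b i = σ.num b i) ∧
    τ.num 3 0 = ∑ j ∈ Finset.range k, π j) ?_ ?_ ?_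
  · rintro i hi τ ⟨h5, hn, hm, h3⟩
    have hE : τ.nat 0 1 = m := by rw [hn _ _ (by omega), h.numEdges]
    refine ⟨by simp [ltTest, Test.Holds, NatExpr.eval, var, numEdges, h5, hE, hi],
      Halts.of_run (by simp [addPenalty, Program.LoopFree]) ?_⟩
    have h2 : τ.num 2 i = π i := by rw [hm _ _ (by omega), h.penalty]
    simp only [addPenalty, Program.run, NatExpr.eval, NumExpr.eval, var, State.setNat_nat,
      State.setNat_num, State.setNum_nat, State.setNum_num, h5, h2, h3, Finset.sum_range_succ]
    refine ⟨by simp, fun b j hb => ?_, fun b j hb => ?_, by simp⟩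
    · rw [if_neg (by tauto), hn _ _ hb]
    · rw [if_neg hb, hm _ _ hb]
  · rintro τ ⟨h5, hn, -⟩
    have hE : τ.nat 0 1 = m := by rw [hn _ _ (by omega), h.numEdges]
    simp [ltTest, Test.Holds, NatExpr.eval, var, numEdges, h5, hE]
  · exact ⟨h.nat_zero _ _ (by omega), fun _ _ _ => rfl, fun _ _ _ => rfl,
      by simpa using h.num_zero 3 0 le_rfl⟩

theorem halts_findEdge {j₀ : ℕ} (hE : σ.nat 0 1 = m) (hj₀ : j₀ < m)
    (h : σ.nat 7 (σ.nat 1 j₀) ≠ σ.nat 7 (σ.nat 2 j₀)) :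
    Halts findEdge ((Program.setNat 5 (.const 0) (.const 0)).size +
      (m * ((ltTest (var 5) numEdges).size + 1 + testEdge.size) +
        ((ltTest (var 5) numEdges).size + 1))) σ fun τ =>
        (∀ b i, b ≠ 5 → b ≠ 6 → τ.nat b i = σ.nat b i) ∧ τ.num = σ.num ∧ τ.nat 6 0 < m ∧
        σ.nat 7 (σ.nat 1 (τ.nat 6 0)) ≠ σ.nat 7 (σ.nat 2 (τ.nat 6 0)) := by
  -- The scan does not stop at a hit; later hits overwrite earlier ones. Until it has passed `j₀`,
  -- entry `6` may still be stale, hence the guard `j₀ < k`.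
  let Inv : ℕ → State K → Prop := fun k τ => τ.nat 5 0 = k ∧
    (∀ b i, b ≠ 5 → b ≠ 6 → τ.nat b i = σ.nat b i) ∧ τ.num = σ.num ∧
    (j₀ < k → τ.nat 6 0 < m ∧
      σ.nat 7 (σ.nat 1 (τ.nat 6 0)) ≠ σ.nat 7 (σ.nat 2 (τ.nat 6 0)))
  refine Halts.mono (Q := Inv m) ?_ fun τ hτ => ⟨hτ.2.1, hτ.2.2.1, hτ.2.2.2 hj₀⟩
  refine Halts.seq (Q := Inv 0) (Halts.of_run (by simp [Program.LoopFree]) ?_) fun ρ hρ =>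
    Halts.loop ?_ ?_ hρ
  · refine ⟨by simp [Program.run, NatExpr.eval, State.setNat_nat], fun b i h5 _ => ?_, rfl, by simp⟩
    simp [Program.run, State.setNat_nat, h5]
  · rintro i hi τ ⟨h5, hn, hm, h6⟩
    have hE' : τ.nat 0 1 = m := by rw [hn _ _ (by omega) (by omega), hE]
    refine ⟨by simp [ltTest, Test.Holds, NatExpr.eval, var, numEdges, h5, hE', hi],
      Halts.of_run (by simp [testEdge, Program.LoopFree]) ?_⟩
    have hn1 : ∀ i, τ.nat 1 i = σ.nat 1 i := fun i => hn _ _ (by omega) (by omega)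
    have hn2 : ∀ i, τ.nat 2 i = σ.nat 2 i := fun i => hn _ _ (by omega) (by omega)
    have hn7 : ∀ i, τ.nat 7 i = σ.nat 7 i := fun i => hn _ _ (by omega) (by omega)
    by_cases hc : σ.nat 7 (σ.nat 1 i) ≤ σ.nat 7 (σ.nat 2 i) ∧
        σ.nat 7 (σ.nat 2 i) ≤ σ.nat 7 (σ.nat 1 i)
    · have hrun : testEdge.run τ = τ.setNat 5 0 (i + 1) := by
        simp [testEdge, Program.run, Test.Holds, NatExpr.eval, var, h5, hn1, hn2, hn7, hc]
      rw [hrun]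
      refine ⟨by simp [State.setNat_nat], fun b j hb hb' => ?_, hm, fun hj => ?_⟩
      · simp [State.setNat_nat, hb, hn b j hb hb']
      · have hne : j₀ ≠ i := by
          rintro rfl
          exact h (le_antisymm hc.1 hc.2)
        simpa [State.setNat_nat] using h6 (by omega)
    · have hrun : testEdge.run τ = (τ.setNat 6 0 i).setNat 5 0 (i + 1) := by
        simp [testEdge, Program.run, Test.Holds, NatExpr.eval, var, h5, hn1, hn2, hn7, hc,
          State.setNat_nat]
      rw [hrun]
      refine ⟨by simp [State.setNat_nat], fun b j hb hb' => ?_, hm, fun _ => ?_⟩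
      · simp [State.setNat_nat, hb, hb', hn b j hb hb']
      · simp only [State.setNat_nat]
        simp only [show ¬ (6 = 5) by omega, false_and, if_false, and_self, if_true]
        exact ⟨hi, fun e => hc ⟨e.le, e.ge⟩⟩
  · rintro τ ⟨h5, hn, -⟩
    have hE' : τ.nat 0 1 = m := by rw [hn _ _ (by omega) (by omega), hE]
    simp [ltTest, Test.Holds, NatExpr.eval, var, numEdges, h5, hE']

theorem run_attach (σ : State K) {k t a b : ℕ} (hk : σ.nat 4 0 = k) (ht : σ.nat 6 0 = t)
    (hab : if σ.nat 7 (σ.nat 1 t) = 0 then a = σ.nat 1 t ∧ b = σ.nat 2 t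
      else a = σ.nat 2 t ∧ b = σ.nat 1 t) :
    ∃ τ, attach.run σ = τ ∧ τ.nat 4 0 = k + 1 ∧
      (∀ x, τ.nat 8 x = if x = k then a else σ.nat 8 x) ∧
      (∀ x, τ.nat 9 x = if x = k then b else σ.nat 9 x) ∧
      (∀ x, τ.nat 10 x = if x = k then t else σ.nat 10 x) ∧
      (∀ x, τ.nat 7 x = if x = a then 1 else σ.nat 7 x) ∧
      (∀ x, τ.num 3 x = if x = a then σ.num 3 0 else σ.num 3 x) ∧
      (∀ d x, d < 4 → τ.nat d x = σ.nat d x) ∧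
      (∀ d x, d ≠ 3 → τ.num d x = σ.num d x) := by
  refine ⟨_, rfl, ?_⟩
  split_ifs at hab with h <;> obtain ⟨rfl, rfl⟩ := hab
  all_goals
    simp [attach, Program.run, Test.Holds, NatExpr.eval, NumExpr.eval, var, curChild,
      State.setNat_nat, State.setNum_nat, State.setNat_num, State.setNum_num, hk, ht, h]
    refine ⟨fun d x hd => ?_, fun d x hd hd' => absurd hd' hd⟩
    repeat rw [if_neg (by omega)]

theorem GrowInv.attach (h : GrowInv m u v nw w π k σ) {τ : State K}
    (hn : ∀ b i, b ≠ 5 → b ≠ 6 → τ.nat b i = σ.nat b i) (hm : τ.num = σ.num)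
    (hlt : τ.nat 6 0 < m)
    (hne : σ.nat 7 (σ.nat 1 (τ.nat 6 0)) ≠ σ.nat 7 (σ.nat 2 (τ.nat 6 0))) :
    GrowInv m u v nw w π (k + 1) (TreeDP.attach.run τ) := by
  set t := τ.nat 6 0 with ht
  obtain ⟨a, b, hab, ha, hb, hs⟩ : ∃ a b, (if τ.nat 7 (τ.nat 1 t) = 0 then
      a = τ.nat 1 t ∧ b = τ.nat 2 t else a = τ.nat 2 t ∧ b = τ.nat 1 t) ∧
      a ∉ prefixNodes (σ.nat 8) k ∧ b ∈ prefixNodes (σ.nat 8) k ∧ s(a, b) = s(u t, v t) := by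
    rw [hn 7 _ (by omega) (by omega), hn 1 _ (by omega) (by omega), hn 2 _ (by omega) (by omega),
      h.left, h.right]
    rw [h.left, h.right, h.mark, h.mark] at hne
    rw [h.mark]
    -- Different marks mean that exactly one end belongs to the tree grown so far: that end is the
    -- parent `b`, the other the child `a`.
    by_cases hu : u t ∈ prefixNodes (σ.nat 8) k <;> by_cases hv : v t ∈ prefixNodes (σ.nat 8) k
    · simp [hu, hv] at hne
    · exact ⟨v t, u t, by simp [hu], hv, hu, Sym2.eq_swap⟩
    · exact ⟨u t, v t, by simp [hu], hu, hv, rfl⟩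
    · simp [hu, hv] at hne
  obtain ⟨ρ, hρ, n4, n8, n9, n10, n7, m3, hn', hm'⟩ := run_attach τ
    ((hn 4 0 (by omega) (by omega)).trans h.counter) ht.symm hab
  rw [hρ]
  have e8 : ∀ i < k, ρ.nat 8 i = σ.nat 8 i := fun i hi => by
    rw [n8, if_neg hi.ne, hn _ _ (by omega) (by omega)]
  have e9 : ∀ i < k, ρ.nat 9 i = σ.nat 9 i := fun i hi => by
    rw [n9, if_neg hi.ne, hn _ _ (by omega) (by omega)]
  have e10 : ∀ i < k, ρ.nat 10 i = σ.nat 10 i := fun i hi => by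
    rw [n10, if_neg hi.ne, hn _ _ (by omega) (by omega)]
  have k8 : ρ.nat 8 k = a := by rw [n8, if_pos rfl]
  have k9 : ρ.nat 9 k = b := by rw [n9, if_pos rfl]
  have k10 : ρ.nat 10 k = t := by rw [n10, if_pos rfl]
  have hS : prefixNodes (ρ.nat 8) k = prefixNodes (σ.nat 8) k := prefixNodes_congr e8
  have hS' : prefixNodes (ρ.nat 8) (k + 1) = insert a (prefixNodes (σ.nat 8) k) := by
    rw [prefixNodes_succ, hS, k8]
  have h30 : σ.num 3 0 = ∑ j ∈ Finset.range m, π j :=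
    h.cost_unpaid 0 (mem_prefixNodes.2 (Or.inl rfl))
  refine ⟨n4, ?_, ?_, ?_, ?_, ?_, ?_, ?_, ?_, ?_, ?_, ?_, ?_, ?_⟩
  · rw [hn' _ _ (by omega), hn _ _ (by omega) (by omega), h.numEdges]
  · intro i; rw [hn' _ _ (by omega), hn _ _ (by omega) (by omega), h.left]
  · intro i; rw [hn' _ _ (by omega), hn _ _ (by omega) (by omega), h.right]
  · intro i; rw [hn' _ _ (by omega), hn _ _ (by omega) (by omega), h.out]
  · intro i; rw [hm' _ _ (by omega), hm, h.nodeWeight]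
  · intro i; rw [hm' _ _ (by omega), hm, h.weight]
  · intro i; rw [hm' _ _ (by omega), hm, h.penalty]
  · intro i; rw [hm' _ _ (by omega), hm, h.cost_out]
  · intro x hx
    rw [m3, hm]
    split_ifs with hxa
    · exact h30
    · rw [hS'] at hx
      exact h.cost_unpaid x ((Finset.mem_insert.1 hx).resolve_left hxa)
  · intro x
    rw [n7, hS', hn _ _ (by omega) (by omega), h.mark]
    by_cases hxa : x = a <;> simp [hxa]
  · refine IsGrowth.succ (h.growth.congr e8 e9) ?_ ?_
    · rw [hS, k9]; exact hb
    · rw [hS, k8]; exact ha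
  · intro i hi
    rcases Nat.lt_succ_iff_lt_or_eq.1 hi with hi | rfl
    · rw [e10 i hi]; exact h.edge_lt i hi
    · rw [k10]; exact hlt
  · intro i hi
    rcases Nat.lt_succ_iff_lt_or_eq.1 hi with hi | rfl
    · rw [e8 i hi, e9 i hi, e10 i hi]; exact h.edge i hi
    · rw [k8, k9, k10]; exact hs

/-- A bound on the number of elementary operations of one round of the growing phase. -/
def roundTime (m : ℕ) : ℕ :=
  (Program.setNat 5 (.const 0) (.const 0)).size +
    (m * ((ltTest (var 5) numEdges).size + 1 + testEdge.size) +
      ((ltTest (var 5) numEdges).size + 1)) + attach.size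

/-- Connectivity is used only through the cut condition `hS`. With `k < m` nodes attached, the grown
part has `k + 1 ≤ m` nodes, so some edge leaves it and the scan succeeds. -/
theorem halts_grow (hS : ∀ S : Finset ℕ, 0 ∈ S → S.card ≤ m → ∃ j < m, ¬ (u j ∈ S ↔ v j ∈ S))
    (h : GrowInv m u v nw w π 0 ((Program.setNat 7 (.const 0) (.const 1)).run σ)) :
    Halts grow ((Program.setNat 7 (.const 0) (.const 1)).size +
      (m * ((ltTest (var 4) numEdges).size + 1 + roundTime m) +
        ((ltTest (var 4) numEdges).size + 1))) σ (GrowInv m u v nw w π m) := by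
  refine Halts.seq (Q := GrowInv m u v nw w π 0) (Halts.of_run (by simp [Program.LoopFree]) h)
    fun ρ hρ => Halts.loop ?_ ?_ hρ
  · intro k hk τ hτ
    refine ⟨by simp [ltTest, Test.Holds, NatExpr.eval, var, numEdges, hτ.counter, hτ.numEdges, hk],
      ?_⟩
    obtain ⟨j, hj, hjS⟩ := hS (prefixNodes (τ.nat 8) k) (mem_prefixNodes.2 (Or.inl rfl))
      (by rw [hτ.growth.card_prefixNodes le_rfl]; exact hk)
    refine Halts.seq (halts_findEdge hτ.numEdges hj ?_) fun ρ ⟨h1, h2, h3, h4⟩ =>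
      Halts.of_run (by simp [TreeDP.attach, Program.LoopFree]) (hτ.attach h1 h2 h3 h4)
    rw [hτ.left, hτ.right, hτ.mark, hτ.mark]
    intro e
    apply hjS
    by_cases h1 : u j ∈ prefixNodes (τ.nat 8) k <;> by_cases h2 : v j ∈ prefixNodes (τ.nat 8) k <;>
      simp_all
  · intro τ hτ
    simp [ltTest, Test.Holds, NatExpr.eval, var, numEdges, hτ.counter, hτ.numEdges]

/-- A bound on the number of elementary operations of the algorithm for a tree with `m` edges. -/
noncomputable def timeBound : Polynomial ℕ :=
  .X * .C ((ltTest (var 5) numEdges).size + 1 + addPenalty.size) +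
    .C ((ltTest (var 5) numEdges).size + 1) +
  (.C (Program.setNat 7 (.const 0) (.const 1)).size +
    (.X * (.C ((ltTest (var 4) numEdges).size + 1) +
      (.C (Program.setNat 5 (.const 0) (.const 0)).size +
        (.X * .C ((ltTest (var 5) numEdges).size + 1 + testEdge.size) +
          .C ((ltTest (var 5) numEdges).size + 1)) + .C attach.size)) +
      .C ((ltTest (var 4) numEdges).size + 1)) +
  (.X * .C ((ltTest (.const 0) (var 4)).size + 1 + eliminate.size) +
    .C ((ltTest (.const 0) (var 4)).size + 1) +
  (.C chooseRoot.size + (.X * .C ((ltTest (var 4) numEdges).size + 1 + decideNext.size) +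
    .C ((ltTest (var 4) numEdges).size + 1)))))

theorem halts_algorithm [IsOrderedAddMonoid K] (h : IsInput m u v nw w π σ)
    (hπ : ∀ j < m, 0 ≤ π j)
    (hS : ∀ S : Finset ℕ, 0 ∈ S → S.card ≤ m → ∃ j < m, ¬ (u j ∈ S ↔ v j ∈ S)) :
    Halts algorithm (timeBound.eval m) σ fun τ => ∃ c p idx : ℕ → ℕ, IsGrowth m c p ∧
      (∀ i < m, idx i < m) ∧ (∀ i < m, s(c i, p i) = s(u (idx i), v (idx i))) ∧
      ∀ F : ℕ → Prop,
        coverCost m c p (fun i => w (idx i)) (fun i => π (idx i)) nw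
          (fun i => τ.nat 3 (idx i) = 1) ≤
        coverCost m c p (fun i => w (idx i)) (fun i => π (idx i)) nw F := by
  simp only [timeBound, Polynomial.eval_add, Polynomial.eval_mul, Polynomial.eval_X,
    Polynomial.eval_C]
  refine (halts_sumPenalties h).seq fun σ₁ ⟨hn₁, hm₁, h3⟩ => ?_
  have hstart : GrowInv m u v nw w π 0 ((Program.setNat 7 (.const 0) (.const 1)).run σ₁) := by
    simp only [Program.run, NatExpr.eval]
    have hz : ∀ b, 3 ≤ b → b ≠ 5 → ∀ i, σ₁.nat b i = 0 := fun b hb hb' i => by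
      rw [hn₁ b i hb', h.nat_zero b i hb]
    refine ⟨?_, ?_, ?_, ?_, ?_, ?_, ?_, ?_, ?_, ?_, ?_, ?_, ?_, ?_⟩
    · simp [State.setNat_nat, hz]
    · simp [State.setNat_nat, hn₁, h.numEdges]
    · simp [State.setNat_nat, hn₁, h.left]
    · simp [State.setNat_nat, hn₁, h.right]
    · simp [State.setNat_nat, hz]
    · simp [State.setNat_num, hm₁, h.nodeWeight]
    · simp [State.setNat_num, hm₁, h.weight]
    · simp [State.setNat_num, hm₁, h.penalty]
    · simp [State.setNat_num, hm₁, h.num_zero]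
    · simp [State.setNat_num, prefixNodes_zero, h3]
    · intro x
      simp [State.setNat_nat, prefixNodes_zero, hz]
    · constructor <;> simp
    · simp
    · simp
  refine (halts_grow hS hstart).seq fun σ₂ hσ₂ => ?_
  have hg := hσ₂.growth
  have hinj := hg.injOn hσ₂.edge
  have hcp : ∀ i < m, σ₂.nat 8 i ≠ σ₂.nat 9 i := fun i hi e =>
    hg.child_notMem i hi (e ▸ hg.parent_mem i hi)
  have helim : EliminateInv m (σ₂.nat 8) (σ₂.nat 9) (σ₂.nat 10) w π (table σ₂) m σ₂ := by
    refine ⟨hσ₂.counter, hσ₂.numEdges, fun _ => rfl, fun _ => rfl, fun _ => rfl, hσ₂.out,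
      hσ₂.weight, hσ₂.penalty, fun _ => table σ₂, rfl, rfl, ?_⟩
    -- Nothing has been eliminated yet, so the tableau conditions range over an empty set of
    -- indices.
    constructor <;> intros <;> omega
  refine (halts_eliminateAll hcp helim).seq fun σ₃ hσ₃ => ?_
  obtain ⟨T, hTm, hT0, hT⟩ := hσ₃.tableau
  refine (halts_decideAll hg hinj hT hT0 hσ₃).mono fun τ hτ =>
    ⟨σ₂.nat 8, σ₂.nat 9, σ₂.nat 10, hg, hσ₂.edge_lt, hσ₂.edge, fun F => ?_⟩
  have t0 : ∀ v ∈ prefixNodes (σ₂.nat 8) m, T m v 0 = 0 := fun v _ => by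
    simp [hTm, table, hσ₂.cost_out]
  have t1 : ∀ v ∈ prefixNodes (σ₂.nat 8) m, T m v 1 =
      ∑ i ∈ Finset.range m, π (σ₂.nat 10 i) := fun v hv => by
    rw [sum_comp_of_injOn hinj hσ₂.edge_lt]
    simp [hTm, table, hσ₂.cost_unpaid v hv]
  have t2 : ∀ v ∈ prefixNodes (σ₂.nat 8) m, T m v 2 = nw v := fun v _ => by
    simp [hTm, table, hσ₂.nodeWeight]
  exact (hτ.solution.coverCost_le hg (fun i hi => hπ _ (hσ₂.edge_lt i hi)) t0 t1 t2).trans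
    (min_le_coverCost hg hT t0 t2 F)

end correctness

end TreeDP

namespace TreeDP

open Finset

/-! ### Translating the objective -/

section objective

theorem mem_dominators {V K : Type*} [Fintype V] [AddCommGroup K] [LinearOrder K]
    {I : EDSInstance V K} {e f : Sym2 V} :
    f ∈ I.dominators e ↔ f ∈ I.edges ∧ ∃ v, v ∈ e ∧ v ∈ f := by
  simp [EDSInstance.dominators]

variable {n m : ℕ} {K : Type*} [AddCommGroup K] [LinearOrder K]

/-- An edge is undominated exactly when neither of its ends is covered, so the three sums agree term
by term once edges are listed in growth order through `E`. -/
theorem objective_eq_coverCost {I : EDSInstance (Fin n) K} {c p : ℕ → ℕ} {w π nw : ℕ → K}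
    {E : ℕ → Sym2 (Fin n)} (hn : n = m + 1) (hg : IsGrowth m c p)
    (hE : Set.BijOn E (Set.Iio m) I.graph.edgeSet)
    (hcp : ∀ i < m, (E i).map Fin.val = s(c i, p i)) (hw : ∀ i < m, w i = I.edgeWeight (E i))
    (hπ : ∀ i < m, π i = I.penalty (E i)) (hnw : ∀ v : Fin n, nw v = I.nodeWeight v)
    {F : Finset (Sym2 (Fin n))} (hF : F ⊆ I.edges) {P : ℕ → Prop} (hP : ∀ i < m, P i ↔ E i ∈ F) :
    I.objective F = coverCost m c p w π nw P := by
  classical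
  have hedges : I.edges = (range m).image E := by
    ext x
    rw [EDSInstance.edges, mem_filter, ← hE.image_eq]
    simp
  have hinj : Set.InjOn E (range m : Set ℕ) := by
    simpa [Set.Iio] using hE.injOn
  have hsum : ∀ g : Sym2 (Fin n) → K, ∑ x ∈ I.edges, g x = ∑ i ∈ range m, g (E i) := by
    intro g
    rw [hedges, sum_image hinj]
  have hmem : ∀ i < m, ∀ v : Fin n, v ∈ E i ↔ (v : ℕ) = c i ∨ (v : ℕ) = p i := by
    intro i hi v
    rw [← Sym2.mem_iff, ← hcp i hi, Sym2.mem_map]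
    constructor
    · intro h
      exact ⟨v, h, rfl⟩
    · rintro ⟨a, ha, hav⟩
      rwa [← Fin.ext hav]
  have hlt : ∀ i < m, c i < n ∧ p i < n := by
    intro i hi
    have hc : c i ∈ (E i).map Fin.val := by rw [hcp i hi]; exact Sym2.mem_mk_left _ _
    have hp : p i ∈ (E i).map Fin.val := by rw [hcp i hi]; exact Sym2.mem_mk_right _ _
    obtain ⟨a, -, ha⟩ := Sym2.mem_map.1 hc
    obtain ⟨b, -, hb⟩ := Sym2.mem_map.1 hp
    exact ⟨ha ▸ a.2, hb ▸ b.2⟩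
  -- All attached nodes are below `n`, and there are `m + 1 = n` of them together with the root.
  have hnodes : prefixNodes c m = range n := by
    refine eq_of_subset_of_card_le ?_ ?_
    · intro v hv
      rcases mem_prefixNodes.1 hv with rfl | ⟨i, hi, rfl⟩
      · exact mem_range.2 (by omega)
      · exact mem_range.2 (hlt i hi).1
    · rw [hg.card_prefixNodes le_rfl, card_range, hn]
  have hcov : ∀ v : Fin n, Covered c p P m v ↔ ∃ f ∈ F, v ∈ f := by
    intro v
    constructor
    · rintro ⟨i, hi, hPi, hv⟩
      exact ⟨E i, (hP i hi).1 hPi, (hmem i hi v).2 hv⟩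
    · rintro ⟨f, hf, hv⟩
      have hf' := hF hf
      rw [hedges] at hf'
      obtain ⟨i, hi, rfl⟩ := mem_image.1 hf'
      have hi := mem_range.1 hi
      exact ⟨i, hi, (hP i hi).2 hf, (hmem i hi v).1 hv⟩
  have hdom : ∀ i < m, Disjoint F (I.dominators (E i)) ↔
      ¬ Covered c p P m (c i) ∧ ¬ Covered c p P m (p i) := by
    intro i hi
    obtain ⟨hci, hpi⟩ := hlt i hi
    have h1 := hcov ⟨c i, hci⟩
    have h2 := hcov ⟨p i, hpi⟩
    simp only at h1 h2
    rw [h1, h2, disjoint_left]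
    have h3 : (⟨c i, hci⟩ : Fin n) ∈ E i := (hmem i hi _).2 (Or.inl rfl)
    have h4 : (⟨p i, hpi⟩ : Fin n) ∈ E i := (hmem i hi _).2 (Or.inr rfl)
    constructor
    · intro h
      constructor <;> rintro ⟨f, hf, hv⟩ <;> refine h hf ?_ <;>
        rw [mem_dominators]
      · exact ⟨hF hf, _, h3, hv⟩
      · exact ⟨hF hf, _, h4, hv⟩
    · rintro ⟨h5, h6⟩ f hf hfd
      rw [mem_dominators] at hfd
      obtain ⟨-, v, hv, hvf⟩ := hfd
      rcases (hmem i hi v).1 hv with h | h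
      · exact h5 ⟨f, hf, by rwa [← show v = ⟨c i, hci⟩ from Fin.ext h]⟩
      · exact h6 ⟨f, hf, by rwa [← show v = ⟨p i, hpi⟩ from Fin.ext h]⟩
  have s1 : ∑ e ∈ F, I.edgeWeight e = ∑ i ∈ range m, if P i then w i else 0 := by
    rw [← inter_eq_right.2 hF, ← filter_mem_eq_inter, sum_filter, hsum]
    refine sum_congr rfl fun i hi => ?_
    have hi := mem_range.1 hi
    simp only [hP i hi, hw i hi]
  have s2 : ∑ v ∈ I.endNodes F, I.nodeWeight v =
      ∑ v ∈ prefixNodes c m, if Covered c p P m v then nw v else 0 := by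
    rw [hnodes, sum_range, EDSInstance.endNodes, sum_filter]
    refine sum_congr rfl fun v _ => ?_
    simp only [hcov, hnw]
    congr
  have s3 : ∑ e ∈ I.undominated F, I.penalty e = ∑ i ∈ range m,
      if ¬ Covered c p P m (c i) ∧ ¬ Covered c p P m (p i) then π i else 0 := by
    rw [EDSInstance.undominated, sum_filter, hsum]
    refine sum_congr rfl fun i hi => ?_
    have hi := mem_range.1 hi
    simp only [hdom i hi, hπ i hi]
  rw [EDSInstance.objective, s1, s2, s3, coverCost, sum_add_distrib]
  abel

end objective

/-! ### Trees and optimality of the output -/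

section tree

variable {n m : ℕ} {K : Type*} [AddCommGroup K] [LinearOrder K]
  {I : EDSInstance (Fin n) K} {ends : Fin m → Fin n × Fin n}

theorem card_eq_of_isEdgeList (hI : I.graph.IsTree) (hl : I.IsEdgeList ends) : n = m + 1 := by
  classical
  have h := hI.card_edgeFinset
  have hm : #I.graph.edgeFinset = m := by
    have : I.graph.edgeFinset = univ.image fun j => s((ends j).1, (ends j).2) := by
      ext x
      rw [SimpleGraph.mem_edgeFinset, ← hl.image_eq]
      simp
    rw [this, card_image_of_injective _ (Set.injOn_univ.1 hl.injOn)]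
    simp
  rw [hm] at h
  simpa using h.symm

/-- A set of at most `m < n` elements misses some node, and a walk from `0` to that node must leave
the set along an edge. -/
theorem exists_crossing_edge (hI : I.graph.IsTree) (hl : I.IsEdgeList ends) {S : Finset ℕ}
    (h0 : 0 ∈ S) (hS : #S ≤ m) :
    ∃ j < m, ¬ ((I.input ends).nat 1 j ∈ S ↔ (I.input ends).nat 2 j ∈ S) := by
  have hn := card_eq_of_isEdgeList hI hl
  obtain ⟨x, hx, hxS⟩ : ∃ x ∈ range n, x ∉ S := by
    by_contra! h
    have := card_le_card (show range n ⊆ S from h)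
    rw [card_range] at this
    omega
  obtain ⟨W⟩ := hI.connected.preconnected ⟨0, by omega⟩ ⟨x, mem_range.1 hx⟩
  obtain ⟨d, -, h1, h2⟩ := W.exists_boundary_dart {y | (y : ℕ) ∈ S} h0 hxS
  obtain ⟨j, -, hj⟩ := hl.surjOn (show s(d.fst, d.snd) ∈ I.graph.edgeSet from d.adj)
  refine ⟨j, j.2, ?_⟩
  simp only [EDSInstance.input, j.2, dif_pos, Fin.eta]
  simp only [Set.mem_ofPred_eq] at h1 h2
  rcases Sym2.eq_iff.1 hj with ⟨e1, e2⟩ | ⟨e1, e2⟩ <;> rw [e1, e2] <;> tauto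

theorem halts_isOptimal [IsOrderedAddMonoid K] (hI : I.graph.IsTree) (hl : I.IsEdgeList ends) :
    RAM.Halts algorithm (timeBound.eval m) (I.input ends) fun τ =>
      I.IsOptimal (EDSInstance.output ends τ) := by
  classical
  have hn := card_eq_of_isEdgeList hI hl
  set e : Fin m → Sym2 (Fin n) := fun j => s((ends j).1, (ends j).2) with he
  have hmem : ∀ j, e j ∈ I.graph.edgeSet := fun j => hl.mapsTo (Set.mem_univ j)
  have hinj : Function.Injective e := Set.injOn_univ.1 hl.injOn
  have hin : IsInput m ((I.input ends).nat 1) ((I.input ends).nat 2) ((I.input ends).num 0)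
      ((I.input ends).num 1) ((I.input ends).num 2) (I.input ends) := by
    refine ⟨by simp [EDSInstance.input], fun _ => rfl, fun _ => rfl, ?_, fun _ => rfl, fun _ => rfl,
      fun _ => rfl, ?_⟩ <;> intro b i hb <;>
      obtain ⟨b, rfl⟩ : ∃ b', b = b' + 3 := ⟨b - 3, by omega⟩ <;> rfl
  refine (halts_algorithm hin ?_ fun S h0 hS => exists_crossing_edge hI hl h0 hS).mono ?_
  · intro j hj
    simp only [EDSInstance.input, hj, dif_pos]
    exact I.penalty_nonneg _ (hmem ⟨j, hj⟩)
  rintro τ ⟨c, p, idx, hg, hlt, hs, hopt⟩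
  have hidx := hg.injOn hs
  have hsub : EDSInstance.output ends τ ⊆ I.edges := by
    intro x hx
    obtain ⟨j, -, rfl⟩ := mem_image.1 hx
    rw [EDSInstance.edges, mem_filter]
    exact ⟨mem_univ _, hmem j⟩
  have hpos : 0 < n := by omega
  -- The loop at node `0` is a default value that is never reached for `i < m`.
  let E : ℕ → Sym2 (Fin n) := fun i =>
    if h : idx i < m then e ⟨idx i, h⟩ else s(⟨0, hpos⟩, ⟨0, hpos⟩)
  have hEe : ∀ i (hi : i < m), E i = e ⟨idx i, hlt i hi⟩ := fun i hi => by
    simp only [E, hlt i hi, dif_pos]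
  have hE : Set.BijOn E (Set.Iio m) I.graph.edgeSet := by
    refine ⟨fun i hi => ?_, fun i hi j hj hij => ?_, fun x hx => ?_⟩
    · rw [hEe i hi]; exact hmem _
    · rw [hEe i hi, hEe j hj] at hij
      exact hidx hi hj (by simpa using hinj hij)
    · obtain ⟨j, -, rfl⟩ := hl.surjOn hx
      have hj : (j : ℕ) ∈ (range m).image idx := by
        rw [image_range_of_injOn hidx hlt]
        exact mem_range.2 j.2
      obtain ⟨i, hi, hij⟩ := mem_image.1 hj
      have hi := mem_range.1 hi
      refine ⟨i, hi, ?_⟩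
      rw [hEe i hi]
      congr
  have hobj : ∀ {F : Finset (Sym2 (Fin n))}, F ⊆ I.edges → ∀ {P : ℕ → Prop},
      (∀ i < m, P i ↔ E i ∈ F) → I.objective F = coverCost m c p
        (fun i => (I.input ends).num 1 (idx i)) (fun i => (I.input ends).num 2 (idx i))
        ((I.input ends).num 0) P := by
    intro F hF P hP
    refine objective_eq_coverCost hn hg hE ?_ ?_ ?_ ?_ hF hP
    · intro i hi
      rw [hs i hi, hEe i hi]
      simp [e, EDSInstance.input, hlt i hi]
    · intro i hi
      rw [hEe i hi]
      simp [e, EDSInstance.input, hlt i hi]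
    · intro i hi
      rw [hEe i hi]
      simp [e, EDSInstance.input, hlt i hi]
    · intro v
      simp [EDSInstance.input]
  refine ⟨hsub, fun F hF => ?_⟩
  rw [hobj hsub (P := fun i => τ.nat 3 (idx i) = 1), hobj hF (P := fun i => E i ∈ F)]
  · exact hopt _
  · exact fun _ _ => Iff.rfl
  · intro i hi
    rw [hEe i hi, EDSInstance.output, hinj.mem_finset_image]
    simp

end tree

/-! ### Bit lengths of rational data -/

section rational

variable {n m : ℕ} (I : EDSInstance (Fin n) ℚ) (ends : Fin m → Fin n × Fin n)

/-- A common denominator of all weights and penalties. -/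
def commonDen : ℕ :=
  (∏ v, (I.nodeWeight v).den) * ∏ j, (I.edgeWeight s((ends j).1, (ends j).2)).den *
    (I.penalty s((ends j).1, (ends j).2)).den

theorem den_le_two_pow (x : ℚ) : x.den ≤ 2 ^ RAM.ratBits x :=
  (Nat.lt_size_self _).le.trans (Nat.pow_le_pow_right (by norm_num) (by unfold RAM.ratBits; omega))

theorem natAbs_num_le_two_pow (x : ℚ) : x.num.natAbs ≤ 2 ^ RAM.ratBits x :=
  (Nat.lt_size_self _).le.trans (Nat.pow_le_pow_right (by norm_num) (by unfold RAM.ratBits; omega))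

theorem commonDen_ne_zero : commonDen I ends ≠ 0 := by
  simp [commonDen, prod_ne_zero_iff]

/-- The product of the denominators is cruder than their least common multiple, but its length is
already bounded by the sum of the input lengths. -/
theorem commonDen_le : commonDen I ends ≤ 2 ^ I.bitSize ends := by
  unfold commonDen EDSInstance.bitSize
  rw [pow_add, ← prod_pow_eq_pow_sum, ← prod_pow_eq_pow_sum]
  refine Nat.mul_le_mul (prod_le_prod' fun v _ => den_le_two_pow _) (prod_le_prod' fun j _ => ?_)
  rw [pow_add, pow_add]
  refine Nat.mul_le_mul (le_trans (den_le_two_pow _) ?_) (den_le_two_pow _)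
  exact Nat.le_mul_of_pos_left _ (by positivity)

/-- Expanding to denominator `D` multiplies the numerator by a factor of at most `D`; numerator and
factor contribute `b` bits each. -/
theorem isShortFraction_of_den_dvd {D b : ℕ} {x : ℚ} (hD : D ≠ 0) (h : x.den ∣ D)
    (hDb : D ≤ 2 ^ b) (hx : RAM.ratBits x ≤ b) : RAM.IsShortFraction D (2 * b) x := by
  obtain ⟨k, rfl⟩ := h
  have hk : k ≠ 0 := right_ne_zero_of_mul hD
  refine ⟨x.num * k, ?_, ?_⟩
  · push_cast
    rw [mul_div_mul_right _ _ (by exact_mod_cast hk), Rat.num_div_den]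
  · rw [Int.natAbs_mul, Int.natAbs_natCast, two_mul, pow_add]
    refine Nat.mul_le_mul ((natAbs_num_le_two_pow x).trans
      (Nat.pow_le_pow_right (by norm_num) hx)) (le_trans ?_ hDb)
    exact Nat.le_mul_of_pos_left _ x.den_pos

/-- Every node weight takes at least its sign bit, so a bound polynomial in the number of nodes is
also polynomial in the bit length. -/
theorem card_le_bitSize : n ≤ I.bitSize ends := by
  have h : ∑ _v : Fin n, 1 ≤ ∑ v, RAM.ratBits (I.nodeWeight v) :=
    sum_le_sum fun v _ => by unfold RAM.ratBits; omega
  simp only [sum_const, card_univ, Fintype.card_fin, smul_eq_mul, mul_one] at h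
  exact h.trans (Nat.le_add_right _ _)

theorem input_isShort (hm : m ≤ n) :
    (I.input ends).IsShort (commonDen I ends) (2 * I.bitSize ends) := by
  have hD := commonDen_ne_zero I ends
  have hDb := commonDen_le I ends
  have hn : n ≤ 2 ^ (2 * I.bitSize ends) :=
    (card_le_bitSize I ends).trans (Nat.lt_two_pow_self.le.trans
      (Nat.pow_le_pow_right (by norm_num) (by omega)))
  have hlt : ∀ x : Fin n, (x : ℕ) ≤ 2 ^ (2 * I.bitSize ends) := fun x => x.2.le.trans hn
  have hterm : ∀ j : Fin m, RAM.ratBits (I.edgeWeight s((ends j).1, (ends j).2)) +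
      RAM.ratBits (I.penalty s((ends j).1, (ends j).2)) ≤ I.bitSize ends := by
    intro j
    refine le_trans ?_ (Nat.le_add_left _ _)
    refine le_trans ?_ (single_le_sum (fun _ _ => Nat.zero_le _) (mem_univ j))
    omega
  constructor
  · intro a i
    match a with
    | 0 => simp only [EDSInstance.input]; split_ifs <;> omega
    | 1 =>
      simp only [EDSInstance.input]
      split_ifs
      · exact hlt _
      · omega
    | 2 =>
      simp only [EDSInstance.input]
      split_ifs
      · exact hlt _
      · omega
    | _ + 3 => exact Nat.zero_le _
  · intro a i
    match a with
    | 0 =>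
      simp only [EDSInstance.input]
      split_ifs with h
      · refine isShortFraction_of_den_dvd hD ?_ hDb ?_
        · exact (dvd_prod_of_mem (fun v => (I.nodeWeight v).den) (mem_univ _)).mul_right _
        · exact (single_le_sum (f := fun v => RAM.ratBits (I.nodeWeight v))
            (fun _ _ => Nat.zero_le _) (mem_univ _)).trans (Nat.le_add_right _ _)
      · exact .zero _ _
    | 1 =>
      simp only [EDSInstance.input]
      split_ifs with h
      · refine isShortFraction_of_den_dvd hD ?_ hDb (by have := hterm ⟨i, h⟩; omega)
        exact ((Dvd.intro _ rfl).trans (dvd_prod_of_mem (fun j =>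
          (I.edgeWeight s((ends j).1, (ends j).2)).den *
            (I.penalty s((ends j).1, (ends j).2)).den) (mem_univ ⟨i, h⟩))).mul_left _
      · exact .zero _ _
    | 2 =>
      simp only [EDSInstance.input]
      split_ifs with h
      · refine isShortFraction_of_den_dvd hD ?_ hDb (by have := hterm ⟨i, h⟩; omega)
        exact ((Dvd.intro_left _ rfl).trans (dvd_prod_of_mem (fun j =>
          (I.edgeWeight s((ends j).1, (ends j).2)).den *
            (I.penalty s((ends j).1, (ends j).2)).den) (mem_univ ⟨i, h⟩))).mul_left _
      · exact .zero _ _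
    | _ + 3 => exact .zero _ _

end rational

theorem polynomial_eval_mono (p : Polynomial ℕ) : Monotone fun x => p.eval x := by
  intro x y h
  simp only [Polynomial.eval_eq_sum, Polynomial.sum]
  exact sum_le_sum fun i _ => Nat.mul_le_mul_left _ (Nat.pow_le_pow_left h i)

end TreeDP

open TreeDP in
/-- One program solves the prize-collecting EDS problem on edge- and node-weighted trees exactly.
For real data it takes a number of elementary operations that is polynomial in the number of
nodes; for rational data its bit complexity is polynomial in the bit length of the instance. -/
theorem theorem1 :
    ∃ A : RAM.Program,
      (∃ p : Polynomial ℕ, ∀ (n m : ℕ) (I : EDSInstance (Fin n) ℝ) (ends : Fin m → Fin n × Fin n),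
        I.graph.IsTree → I.IsEdgeList ends →
        ∃ (t : ℕ) (τ : RAM.State ℝ),
          RAM.Exec (RAM.unitCost ℝ) A (I.input ends) t τ ∧ t ≤ p.eval n ∧
          I.IsOptimal (EDSInstance.output ends τ)) ∧
      (∃ q : Polynomial ℕ, ∀ (n m : ℕ) (I : EDSInstance (Fin n) ℚ) (ends : Fin m → Fin n × Fin n),
        I.graph.IsTree → I.IsEdgeList ends →
        ∃ (t : ℕ) (τ : RAM.State ℚ),
          RAM.Exec RAM.bitCost A (I.input ends) t τ ∧ t ≤ q.eval (I.bitSize ends) ∧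
          I.IsOptimal (EDSInstance.output ends τ)) := by
  -- With `L` the bit length, `Exec.bit_of_unit` needs `C ≥ b + t + d + 3`. Here `b` is `2 * L` for
  -- the input plus `algorithm.maxConst`, so that the constants of the program fit as well, and `d =
  -- L` for the common denominator. This gives the second factor.
  refine ⟨algorithm, ⟨timeBound, fun n m I ends hI hl => ?_⟩,
    ⟨timeBound * (3 * .X + .C algorithm.maxConst + timeBound + 3), fun n m I ends hI hl => ?_⟩⟩
  · have hn := card_eq_of_isEdgeList hI hl
    obtain ⟨t, ht, τ, hτ, hopt⟩ := halts_isOptimal hI hl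
    exact ⟨t, τ, hτ, ht.trans (polynomial_eval_mono _ (by omega)), hopt⟩
  · have hn := card_eq_of_isEdgeList hI hl
    have hX := card_le_bitSize I ends
    obtain ⟨t, ht, τ, hτ, hopt⟩ := halts_isOptimal hI hl
    have ht' : t ≤ timeBound.eval (I.bitSize ends) :=
      ht.trans (polynomial_eval_mono _ (by omega))
    obtain ⟨-, t', ht₁, hτ'⟩ := hτ.bit_of_unit (b := 2 * I.bitSize ends + algorithm.maxConst)
      (C := 3 * I.bitSize ends + algorithm.maxConst + timeBound.eval (I.bitSize ends) + 3)
      (commonDen_ne_zero I ends) (commonDen_le I ends)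
      ((input_isShort I ends (by omega)).mono (by omega))
      (Nat.lt_two_pow_self.le.trans (Nat.pow_le_pow_right (by norm_num) (by omega))) (by omega)
    refine ⟨t', τ, hτ', ht₁.trans ?_, hopt⟩
    simp only [Polynomial.eval_mul, Polynomial.eval_add, Polynomial.eval_X, Polynomial.eval_C,
      Polynomial.eval_ofNat]
    exact Nat.mul_le_mul_right _ ht'
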